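/- \textbf{Setting.} Let $d\ge 1$ and let $\mu,\sigma_0$ be probability measures on $\mathbb{R}^d$ with finite second moments, both absolutely continuous with respect to Lebesgue measure. Write $\mathrm{M}_2(\nu)=\int\|x\|^2\,d\nu(x)$, let $\nu^\theta$ be the push-forward of $\nu$ by $x\mapsto\langle x,\theta\rangle$, and let $\mathscr F(\sigma)=\frac d2\int_{\mathbb S^{d-1}}W_2^2(\sigma^\theta,\mu^\theta)\,d\mathcal U(\theta)$, where $\mathcal U$ is the uniform distribution on the sphere. Let $\nabla_{W_2}\mathscr F(\sigma)$ be the Wasserstein gradient of $\mathscr F$ at $\sigma$: the vector field $v$ in the $L^2(\sigma)$-closure of $\{\nabla\psi:\psi\in C_c^\infty(\mathbb{R}^d)\}$ such that $\mathscr F(\nu)=\mathscr F(\sigma)+\int\langle v(x),y-x\rangle\,d\pi(x,y)+o(W_2(\sigma,\nu))$ for all $\nu$ with finite second moment and all optimal couplings $\pi$ of $\sigma$ and $\nu$. Put $\|v\|_\sigma^2=\int\|v\|^2\,d\sigma$. For an orthonormal basis $P=[\theta_1,\dots,\theta_d]$ let $T_{\sigma,P}(x)=\sum_{i=1}^d t_{\theta_i}(\langle\theta_i,x\rangle)\,\theta_i$,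 where $t_\theta=F_{\mu^\theta}^{-1}\circ F_{\sigma^\theta}$ is the one-dimensional optimal transport map from $\sigma^\theta$ to $\mu^\theta$. Let $P_1,P_2,\dots$ be i.i.d. random orthonormal bases with the Haar distribution and, for step sizes $\gamma_k>0$, let $$\sigma_{k+1}=\big((1-\gamma_k)\,\mathrm{Id}+\gamma_kT_{\sigma_k,P_{k+1}}\big)_\sharp\sigma_k\qquad(k\ge0).$$ \textbf{Assumption $A_\tau$} ($\tau\in\{1,2\}$). For all $k\ge1$, almost surely $\mathscr F(\sigma_k)^\tau\le B_k\|\nabla_{W_2}\mathscr F(\sigma_k)\|_{\sigma_k}^2$, where $(B_k)_{k\ge1}$ are positive random variables with $\sup_{k\ge1}\mathbb E[B_k^p]\le c_p$ for every integer $p\ge1$, with constants $c_p\in(0,\infty)$. \textbf{Theorem.} (1) Let $\gamma_k=(k+1)^{-\alpha}$ with $1/2<\alpha<1$ and suppose that $A_1$ holds. Then there is a constant $C>0$, depending only on $\alpha$, $(c_p)_{p\ge 1}$ and $\mathrm{M}_2(\mu)$, such that for all $k\ge1$ $$\mathbb E[\mathscr F(\sigma_k)]\le\frac{C}{k^{2\alpha-1}}.$$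 (2) Let $1/2<\alpha<2/3$, let $p\ge 2\alpha/(2-3\alpha)$ be an integer, let $\gamma=(2\,\mathrm{M}_2(\mu)\sqrt{c_p})^{3/2}$, and assume $\gamma\ge1$ (which can always be achieved by enlarging the bound $c_p$). Let $\gamma_k=(k+\gamma)^{-\alpha}$ and suppose that $A_2$ holds. Then there is a constant $C>0$, depending only on $\alpha$, $p$, $(c_q)_{q\ge 1}$, $\mathrm{M}_2(\mu)$ and $\mathrm{M}_2(\sigma_0)$, such that for all $k\ge1$ $$\mathbb E[\mathscr F(\sigma_k)]\le\frac{C}{(k+\gamma)^{2\alpha-1}}.$$ -/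

import Mathlib

open MeasureTheory

namespace SliceMatching

noncomputable section

/-- The Euclidean space `ℝ^d`. -/
abbrev E (d : ℕ) : Type := EuclideanSpace ℝ (Fin d)

/-- Orthonormal bases of `ℝ^d`, as orthogonal matrices; the basis vectors are the columns. -/
abbrev Basis (d : ℕ) : Type := Matrix.orthogonalGroup (Fin d) ℝ

instance instMeasurableSpaceBasis (d : ℕ) : MeasurableSpace (Basis d) := borel _

instance instBorelSpaceBasis (d : ℕ) : BorelSpace (Basis d) := ⟨rfl⟩

/-- The `i`-th vector (column) of an orthonormal basis. -/
def dir {d : ℕ} (P : Basis d) (i : Fin d) : E d :=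
  WithLp.toLp 2 (fun j => (P : Matrix (Fin d) (Fin d) ℝ) j i)

/-! ### Measures with finite second moment, and the Wasserstein distance -/

/-- `ν` is a probability measure with finite second moment. -/
structure IsP2 {X : Type*} [NormedAddCommGroup X] [MeasurableSpace X] (ν : Measure X) : Prop where
  prob : IsProbabilityMeasure ν
  moment : Integrable (fun x => ‖x‖ ^ 2) ν

/-- `ν` is a probability measure on `ℝ^d` with finite second moment, absolutely continuous with
respect to the Lebesgue measure. -/
structure IsP2ac {d : ℕ} (ν : Measure (E d)) : Prop extends IsP2 ν where
  ac : ν ≪ volume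

/-- The second moment `M₂(ν) = ∫ ‖x‖² dν(x)`. -/
def M2 {d : ℕ} (ν : Measure (E d)) : ℝ := ∫ x, ‖x‖ ^ 2 ∂ν

/-- The couplings of `ν₁` and `ν₂`. -/
def couplings {X : Type*} [MeasurableSpace X] (ν₁ ν₂ : Measure X) : Set (Measure (X × X)) :=
  {π | π.map Prod.fst = ν₁ ∧ π.map Prod.snd = ν₂}

/-- The quadratic transport cost of a plan. -/
def cost {X : Type*} [NormedAddCommGroup X] [MeasurableSpace X] (π : Measure (X × X)) : ENNReal :=
  ∫⁻ z, ‖z.1 - z.2‖ₑ ^ 2 ∂π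

/-- The squared Wasserstein distance `W₂²`. -/
def W2sq {X : Type*} [NormedAddCommGroup X] [MeasurableSpace X] (ν₁ ν₂ : Measure X) : ENNReal :=
  ⨅ π ∈ couplings ν₁ ν₂, cost π

/-- The Wasserstein distance `W₂`, as a real number. -/
def W2 {X : Type*} [NormedAddCommGroup X] [MeasurableSpace X] (ν₁ ν₂ : Measure X) : ℝ :=
  Real.sqrt (W2sq ν₁ ν₂).toReal

/-- The optimal couplings of `ν₁` and `ν₂`. -/
def optimalCouplings {X : Type*} [NormedAddCommGroup X] [MeasurableSpace X]
    (ν₁ ν₂ : Measure X) : Set (Measure (X × X)) :=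
  {π | π ∈ couplings ν₁ ν₂ ∧ cost π = W2sq ν₁ ν₂}

/-! ### The sliced Wasserstein loss -/

/-- The projection `ν^θ` of `ν`: the push-forward by `x ↦ ⟨x, θ⟩`. -/
def proj {d : ℕ} (ν : Measure (E d)) (θ : E d) : Measure ℝ := ν.map (fun x => inner ℝ θ x)

/-- The uniform probability distribution on the unit sphere of `ℝ^d`. -/
def sphereUniform (d : ℕ) : Measure (Metric.sphere (0 : E d) 1) :=
  ((volume : Measure (E d)).toSphere Set.univ)⁻¹ • (volume : Measure (E d)).toSphere

/-- The squared sliced Wasserstein distance `SW₂²`. -/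
def SW2sq {d : ℕ} (σ μ : Measure (E d)) : ENNReal :=
  ∫⁻ θ, W2sq (proj σ (θ : E d)) (proj μ (θ : E d)) ∂(sphereUniform d)

/-- The loss `F(σ) = (d / 2) SW₂²(σ, μ)`, for the target `μ`. -/
def loss {d : ℕ} (μ σ : Measure (E d)) : ℝ := (d : ℝ) / 2 * (SW2sq σ μ).toReal

/-! ### The Wasserstein gradient -/

/-- `v` belongs to the tangent space of the Wasserstein space at `σ`, that is, to the closure in
`L²(σ)` of the gradients of smooth compactly supported functions. -/
def InTangentSpace {d : ℕ} (σ : Measure (E d)) (v : E d → E d) : Prop :=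
  MemLp v 2 σ ∧ ∀ ε : ENNReal, 0 < ε → ∃ ψ : E d → ℝ,
    ContDiff ℝ ((⊤ : ℕ∞) : WithTop ℕ∞) ψ ∧ HasCompactSupport ψ ∧
      eLpNorm (fun x => v x - gradient ψ x) 2 σ ≤ ε

/-- `v` is a Wasserstein gradient at `σ` of the functional `G` on the Wasserstein space: it is
tangent at `σ` and `G(ν) = G(σ) + ∫ ⟨v(x), y - x⟩ dπ(x, y) + o(W₂(σ, ν))` for all `ν` with finite
second moment and all optimal couplings `π` of `σ` and `ν`. -/
def IsWassersteinGradient {d : ℕ} (G : Measure (E d) → ℝ) (σ : Measure (E d))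
    (v : E d → E d) : Prop :=
  InTangentSpace σ v ∧ ∀ ε : ℝ, 0 < ε → ∃ δ : ℝ, 0 < δ ∧ ∀ ν : Measure (E d), IsP2 ν →
    W2 σ ν ≤ δ → ∀ π ∈ optimalCouplings σ ν,
      |G ν - G σ - ∫ z, inner ℝ (v z.1) (z.2 - z.1) ∂π| ≤ ε * W2 σ ν

open Classical in
/-- The Wasserstein gradient `∇_{W₂} G(σ)` (a vector field, determined `σ`-almost everywhere). -/
def wassersteinGradient {d : ℕ} (G : Measure (E d) → ℝ) (σ : Measure (E d)) : E d → E d :=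
  if h : ∃ v, IsWassersteinGradient G σ v then h.choose else 0

/-- The squared norm `‖v‖²_σ` of a vector field in `L²(σ)`. -/
def normSq {d : ℕ} (σ : Measure (E d)) (v : E d → E d) : ℝ := ∫ x, ‖v x‖ ^ 2 ∂σ

/-! ### The slice-matching scheme -/

/-- The quantile function (generalized inverse of the distribution function) of `ρ`. -/
def quantile (ρ : Measure ℝ) (u : ℝ) : ℝ := sInf {x : ℝ | u ≤ ProbabilityTheory.cdf ρ x}

/-- The one-dimensional optimal transport map from `ρ₁` (without atoms) to `ρ₂`, given by
composing the quantile function of `ρ₂` with the distribution function of `ρ₁`. -/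
def otMap (ρ₁ ρ₂ : Measure ℝ) (s : ℝ) : ℝ := quantile ρ₂ (ProbabilityTheory.cdf ρ₁ s)

/-- The slice-matching map
`T_{σ,P}(x) = ∑ᵢ t_{θᵢ}(⟨θᵢ, x⟩) θᵢ`, where `t_θ` is the transport map from `σ^θ` to `μ^θ`. -/
def sliceMap {d : ℕ} (μ σ : Measure (E d)) (P : Basis d) (x : E d) : E d :=
  ∑ i, otMap (proj σ (dir P i)) (proj μ (dir P i)) (inner ℝ (dir P i) x) • dir P i

/-- The iterates `σ_{k+1} = ((1 - γ_k) Id + γ_k T_{σ_k, P_{k+1}})_♯ σ_k`. The basis that is used in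
the step from `σ_k` to `σ_{k+1}` is written `P k` here. -/
def iterate {d : ℕ} (μ σ₀ : Measure (E d)) (γ : ℕ → ℝ) (P : ℕ → Basis d) : ℕ → Measure (E d)
  | 0 => σ₀
  | k + 1 =>
    (iterate μ σ₀ γ P k).map
      (fun x => (1 - γ k) • x + γ k • sliceMap μ (iterate μ σ₀ γ P k) (P k) x)

/-- `P` is an i.i.d. sequence of random orthonormal bases drawn according to the (normalized) Haar
measure. -/
structure IsHaarSequence {d : ℕ} {Ω : Type*} [MeasurableSpace Ω] (ℙ : Measure Ω)
    (P : ℕ → Ω → Basis d) : Prop where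
  meas : ∀ k, Measurable (P k)
  haar : ∀ k, (ℙ.map (P k)).IsHaarMeasure
  indep : ProbabilityTheory.iIndepFun P ℙ

/-- The Łojasiewicz inequality `F(σ_k)^τ ≤ B_k ‖∇_{W₂} F(σ_k)‖²_{σ_k}` along the random sequence
`σ`, for `k ≥ 1`, where the `B_k` are positive random variables such that
`sup_{k ≥ 1} E[B_k^p] ≤ c_p` for every integer `p ≥ 1`. -/
structure LojasiewiczAlong {d : ℕ} {Ω : Type*} [MeasurableSpace Ω] (ℙ : Measure Ω)
    (μ : Measure (E d)) (σ : ℕ → Ω → Measure (E d)) (τ : ℕ) (B : ℕ → Ω → ℝ) (c : ℕ → ℝ) :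
    Prop where
  meas : ∀ k, 1 ≤ k → AEMeasurable (B k) ℙ
  pos : ∀ k, 1 ≤ k → ∀ᵐ ω ∂ℙ, 0 < B k ω
  moment : ∀ k, 1 ≤ k → ∀ p : ℕ, 1 ≤ p →
    Integrable (fun ω => B k ω ^ p) ℙ ∧ ∫ ω, B k ω ^ p ∂ℙ ≤ c p
  ineq : ∀ k, 1 ≤ k → ∀ᵐ ω ∂ℙ,
    loss μ (σ k ω) ^ τ ≤ B k ω * normSq (σ k ω) (wassersteinGradient (loss μ) (σ k ω))

end

end SliceMatching

/-!
# Convergence rates of the slice-matching scheme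

Write `ν` for the Haar distribution of a random orthonormal basis and `T_P` for the slice-matching
map of the current iterate `σ`. A column of a Haar distributed basis is uniform on the sphere
(`map_dir_eq_sphereUniform`), and the monotone rearrangement is optimal on the line
(`W2sq_eq_otMap`). Therefore `F(σ) = (1/2) ∫∫ ‖x - T_P x‖² dσ dν`, whereas for every map `S`, since
`S` and `T_P` induce couplings of the projections,
`F(S_♯ σ) ≤ (1/2) ∫∫ ‖S x - T_P x‖² dσ dν` (`loss_eq_integral`, `loss_map_le_integral`).

Expanding the square for `S = Id + u` shows that the loss is semiconcave along perturbations of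
the identity, with derivative the mean displacement `g(x) = ∫ (x - T_P x) dν` (`loss_map_add_le`).
There are two consequences.

* Taking `u = γ (T_Q - Id)` and averaging over the basis `Q`, one step of the scheme satisfies
  `E F(σ') ≤ (1 + γ²) F(σ) - γ ‖g‖²` (`integral_loss_step_le`).
* Taking `u = t ∇ψ` with `t` small, for which `Id + u` is an optimal map, every Wasserstein gradient
  `v` satisfies `⟨v, ∇ψ⟩ ≤ ⟨g, ∇ψ⟩`, whence `‖v‖ ≤ ‖g‖` by the density of gradients in the tangent
  space (`normSq_wassersteinGradient_le`).

The iterates remain absolutely continuous: in the coordinates of the basis, a step acts on each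
coordinate separately, and an absolutely continuous measure is absolutely continuous with respect to
the product of its marginals (`map_step_absolutelyContinuous`). Since the new basis is independent of
the current iterate, both estimates combine to
`E F(σ_{k+1}) ≤ (1 + γ_k²) E F(σ_k) - γ_k E R` for every integrable lower bound `R` of the squared
norm of the gradient (`integral_loss_iterate_succ_le`).

The Łojasiewicz inequality provides, for every `λ > 0`, such bounds that are affine in `F` and in
positive powers of `B`: `R = λ F - λ^(n+1) F B^n` for `τ = 1`, where `F` is bounded by `2 M₂(μ)` from
the first iterate on because the first step size is `1`, and `R = λ F - λ² B / 4` for `τ = 2`. With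
`λ` chosen in each step such that `γ_k λ` is a multiple of the reciprocal of `k` (shifted), the
recursion becomes linear and gives the rate (`rate_of_recursion`).
-/

open MeasureTheory

namespace SliceMatching

noncomputable section

/-! ### Quantiles and monotone transport on the line -/

/-- The Galois connection between the quantile function and the distribution function. It holds as
soon as the set defining the quantile is nonempty and bounded below. -/
lemma quantile_le_iff (ρ : Measure ℝ) {u : ℝ} (hu : 0 < u)
    (hne : ∃ x, u ≤ ProbabilityTheory.cdf ρ x) (x : ℝ) :
    quantile ρ u ≤ x ↔ u ≤ ProbabilityTheory.cdf ρ x := by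
  have hbdd : BddBelow {x : ℝ | u ≤ ProbabilityTheory.cdf ρ x} := by
    obtain ⟨N, hN⟩ := ((ProbabilityTheory.tendsto_cdf_atBot ρ).eventually
      (gt_mem_nhds hu)).exists
    refine ⟨N, fun y hy => ?_⟩
    by_contra! hlt
    exact absurd (hy.trans (ProbabilityTheory.monotone_cdf ρ hlt.le)) (not_le.2 hN)
  constructor
  · intro h
    -- by right continuity, the infimum defining the quantile is attained
    have key : ∀ y, x < y → u ≤ ProbabilityTheory.cdf ρ y := by
      intro y hy
      obtain ⟨z, hz, hzy⟩ := exists_lt_of_csInf_lt hne (lt_of_le_of_lt h hy)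
      exact le_trans hz (ProbabilityTheory.monotone_cdf ρ hzy.le)
    have hc : ContinuousWithinAt (ProbabilityTheory.cdf ρ) (Set.Ioi x) x :=
      ((ProbabilityTheory.cdf ρ).right_continuous x).mono Set.Ioi_subset_Ici_self
    refine ge_of_tendsto hc ?_
    filter_upwards [self_mem_nhdsWithin] with y hy using key y hy
  · intro h
    exact csInf_le hbdd h

lemma exists_le_cdf_of_lt_one (ρ : Measure ℝ) {u : ℝ} (hu : u < 1) :
    ∃ x, u ≤ ProbabilityTheory.cdf ρ x := by
  obtain ⟨x, hx⟩ := ((ProbabilityTheory.tendsto_cdf_atTop ρ).eventually (lt_mem_nhds hu)).exists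
  exact ⟨x, hx.le⟩

/-- Quantiles depend measurably on a parameter and on the level. -/
lemma measurable_quantile {Θ : Type*} [MeasurableSpace Θ] (κ : Θ → Measure ℝ)
    (hκ : ∀ x : ℝ, Measurable fun θ => ProbabilityTheory.cdf (κ θ) x) :
    Measurable fun z : Θ × ℝ => quantile (κ z.1) z.2 := by
  have hle : ∀ x : ℝ, MeasurableSet {z : Θ × ℝ | z.2 ≤ ProbabilityTheory.cdf (κ z.1) x} :=
    fun x => measurableSet_le measurable_snd ((hκ x).comp measurable_fst)
  -- outside the set `good` the quantile is the infimum of a set that is empty or unbounded below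
  let good : Set (Θ × ℝ) :=
    {z | 0 < z.2} ∩ ⋃ n : ℕ, {z : Θ × ℝ | z.2 ≤ ProbabilityTheory.cdf (κ z.1) n}
  have hgood : MeasurableSet good :=
    (measurableSet_lt measurable_const measurable_snd).inter
      (MeasurableSet.iUnion fun n => hle n)
  refine measurable_of_Iic fun x => ?_
  have : (fun z : Θ × ℝ => quantile (κ z.1) z.2) ⁻¹' Set.Iic x =
      (good ∩ {z : Θ × ℝ | z.2 ≤ ProbabilityTheory.cdf (κ z.1) x}) ∪
        (goodᶜ ∩ {_z : Θ × ℝ | 0 ≤ x}) := by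
    ext z
    by_cases hz : z ∈ good
    · obtain ⟨h0, hn⟩ := hz
      have hz : z ∈ good := ⟨h0, hn⟩
      obtain ⟨n, hn⟩ := Set.mem_iUnion.1 hn
      simp only [Set.mem_preimage, Set.mem_Iic, Set.mem_union, Set.mem_inter_iff, hz, true_and,
        Set.mem_compl_iff, not_true_eq_false, false_and, or_false, Set.mem_ofPred_eq]
      exact quantile_le_iff _ h0 ⟨n, hn⟩ x
    · have hq : quantile (κ z.1) z.2 = 0 := by
        unfold quantile
        by_cases h0 : 0 < z.2
        · have hempty : {x : ℝ | z.2 ≤ ProbabilityTheory.cdf (κ z.1) x} = ∅ := by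
            by_contra hne
            obtain ⟨y, hy⟩ := Set.nonempty_iff_ne_empty.2 hne
            obtain ⟨n, hn⟩ := exists_nat_ge y
            exact hz ⟨h0, Set.mem_iUnion.2
              ⟨n, le_trans hy (ProbabilityTheory.monotone_cdf _ hn)⟩⟩
          rw [hempty, Real.sInf_empty]
        · have huniv : {x : ℝ | z.2 ≤ ProbabilityTheory.cdf (κ z.1) x} = Set.univ :=
            Set.eq_univ_of_forall fun y =>
              le_trans (not_lt.1 h0) (ProbabilityTheory.cdf_nonneg _ y)
          rw [huniv, Real.sInf_univ]
      simp [hz, hq]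
  rw [this]
  exact (hgood.inter (hle x)).union (hgood.compl.inter (MeasurableSet.const _))

lemma measurable_otMap (ρ₁ ρ₂ : Measure ℝ) : Measurable (otMap ρ₁ ρ₂) := by
  have h := measurable_quantile (fun _ : Unit => ρ₂) (fun x => measurable_const)
  exact h.comp (g := fun z : Unit × ℝ => quantile ρ₂ z.2)
    ((measurable_const (a := ())).prodMk (ProbabilityTheory.monotone_cdf ρ₁).measurable)

/-- The set of points with levels strictly between `0` and `1`; outside of it, the generalized
inverse of a distribution function takes conventional values. -/
def cdfInterior (ρ : Measure ℝ) : Set ℝ :=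
  {s | 0 < ProbabilityTheory.cdf ρ s ∧ ProbabilityTheory.cdf ρ s < 1}

lemma otMap_le_iff (ρ₁ ρ₂ : Measure ℝ) {s : ℝ} (hs : s ∈ cdfInterior ρ₁) (x : ℝ) :
    otMap ρ₁ ρ₂ s ≤ x ↔ ProbabilityTheory.cdf ρ₁ s ≤ ProbabilityTheory.cdf ρ₂ x :=
  quantile_le_iff ρ₂ hs.1 (exists_le_cdf_of_lt_one ρ₂ hs.2) x

lemma monotoneOn_otMap (ρ₁ ρ₂ : Measure ℝ) : MonotoneOn (otMap ρ₁ ρ₂) (cdfInterior ρ₁) := by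
  intro s hs t ht hst
  rw [otMap_le_iff ρ₁ ρ₂ hs]
  exact (ProbabilityTheory.monotone_cdf ρ₁ hst).trans ((otMap_le_iff ρ₁ ρ₂ ht _).1 le_rfl)

lemma continuous_cdf (ρ : Measure ℝ) [IsProbabilityMeasure ρ] [NullSingletonClass ρ] :
    Continuous (ProbabilityTheory.cdf ρ) := by
  rw [continuous_iff_continuousAt]
  intro x
  rw [(ProbabilityTheory.monotone_cdf ρ).continuousAt_iff_leftLim_eq_rightLim,
    StieltjesFunction.rightLim_eq]
  have h := (ProbabilityTheory.cdf ρ).measure_singleton x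
  rw [ProbabilityTheory.measure_cdf, measure_singleton] at h
  have h2 := ENNReal.ofReal_eq_zero.1 h.symm
  exact le_antisymm ((ProbabilityTheory.monotone_cdf ρ).leftLim_le le_rfl) (by linarith)

lemma exists_cdf_eq (ρ : Measure ℝ) [IsProbabilityMeasure ρ] [NullSingletonClass ρ] {c : ℝ} (h0 : 0 < c)
    (h1 : c < 1) : ∃ a, ProbabilityTheory.cdf ρ a = c := by
  obtain ⟨x, hx⟩ := ((ProbabilityTheory.tendsto_cdf_atBot ρ).eventually (gt_mem_nhds h0)).exists
  obtain ⟨y, hy⟩ := ((ProbabilityTheory.tendsto_cdf_atTop ρ).eventually (lt_mem_nhds h1)).exists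
  exact mem_range_of_exists_le_of_exists_ge (continuous_cdf ρ) ⟨x, hx.le⟩ ⟨y, hy.le⟩

/-- The probability integral transform: the distribution function of an atomless measure pushes
it to the uniform distribution on the unit interval. -/
lemma measure_cdf_le (ρ : Measure ℝ) [IsProbabilityMeasure ρ] [NullSingletonClass ρ] {c : ℝ} (h0 : 0 ≤ c)
    (h1 : c ≤ 1) : ρ {s | ProbabilityTheory.cdf ρ s ≤ c} = ENNReal.ofReal c := by
  rcases h1.eq_or_lt with rfl | h1
  · simp [ProbabilityTheory.cdf_le_one]
  apply le_antisymm
  · refine ENNReal.le_of_forall_pos_le_add fun ε hε _ => ?_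
    obtain ⟨c', hc', hc'1⟩ := exists_between (lt_min h1 (lt_add_of_pos_right c (NNReal.coe_pos.2 hε)))
    obtain ⟨a, ha⟩ := exists_cdf_eq ρ (h0.trans_lt hc') (hc'1.trans_le (min_le_left _ _))
    calc ρ {s | ProbabilityTheory.cdf ρ s ≤ c} ≤ ρ (Set.Iic a) := by
          refine measure_mono fun s hs => ?_
          by_contra! hlt
          rw [Set.mem_Iic, not_le] at hlt
          have := ProbabilityTheory.monotone_cdf ρ hlt.le
          simp only [Set.mem_ofPred_eq] at hs
          linarith
      _ = ENNReal.ofReal c' := by rw [← ProbabilityTheory.ofReal_cdf, ha]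
      _ ≤ ENNReal.ofReal (c + ε) := ENNReal.ofReal_le_ofReal (hc'1.le.trans (min_le_right _ _))
      _ = ENNReal.ofReal c + ε := by
          rw [ENNReal.ofReal_add h0 ε.coe_nonneg, ENNReal.ofReal_coe_nnreal]
  · rcases h0.eq_or_lt with rfl | h0
    · simp
    obtain ⟨a, ha⟩ := exists_cdf_eq ρ h0 h1
    rw [← ha, ProbabilityTheory.ofReal_cdf]
    exact measure_mono fun s hs => ProbabilityTheory.monotone_cdf ρ hs

lemma measure_compl_cdfInterior (ρ : Measure ℝ) [IsProbabilityMeasure ρ] [NullSingletonClass ρ] :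
    ρ (cdfInterior ρ)ᶜ = 0 := by
  have h : (cdfInterior ρ)ᶜ ⊆ {s | ProbabilityTheory.cdf ρ s ≤ 0} ∪
      {s | ProbabilityTheory.cdf ρ s < 1}ᶜ := by
    intro s hs
    by_cases h0 : ProbabilityTheory.cdf ρ s ≤ 0
    · exact Or.inl h0
    · exact Or.inr fun h1 => hs ⟨not_le.1 h0, h1⟩
  refine measure_mono_null h (measure_union_null ?_ ?_)
  · rw [measure_cdf_le ρ le_rfl zero_le_one, ENNReal.ofReal_zero]
  · rw [prob_compl_eq_zero_iff
      (measurableSet_lt (ProbabilityTheory.monotone_cdf ρ).measurable measurable_const)]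
    refine le_antisymm prob_le_one ?_
    refine le_of_forall_lt fun b hb => ?_
    have hb1 : b.toReal < 1 := by
      simpa using (ENNReal.toReal_lt_toReal hb.ne_top ENNReal.one_ne_top).2 hb
    obtain ⟨c, hbc, hc⟩ := exists_between hb1
    calc b = ENNReal.ofReal b.toReal := (ENNReal.ofReal_toReal hb.ne_top).symm
      _ < ENNReal.ofReal c := (ENNReal.ofReal_lt_ofReal_iff
          (ENNReal.toReal_nonneg.trans_lt hbc)).2 hbc
      _ = ρ {s | ProbabilityTheory.cdf ρ s ≤ c} :=
          (measure_cdf_le ρ (ENNReal.toReal_nonneg.trans hbc.le) hc.le).symm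
      _ ≤ _ := measure_mono fun s hs => lt_of_le_of_lt hs hc

/-- The map `otMap` transports an atomless measure to its target. -/
lemma map_otMap (ρ₁ ρ₂ : Measure ℝ) [IsProbabilityMeasure ρ₁] [NullSingletonClass ρ₁]
    [IsProbabilityMeasure ρ₂] : ρ₁.map (otMap ρ₁ ρ₂) = ρ₂ := by
  have : IsProbabilityMeasure (ρ₁.map (otMap ρ₁ ρ₂)) :=
    Measure.isProbabilityMeasure_map (measurable_otMap _ _).aemeasurable
  refine Measure.ext_of_Iic _ _ fun b => ?_
  rw [Measure.map_apply (measurable_otMap _ _) measurableSet_Iic, ← ProbabilityTheory.ofReal_cdf ρ₂,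
    ← measure_cdf_le ρ₁ (ProbabilityTheory.cdf_nonneg _ _) (ProbabilityTheory.cdf_le_one _ _)]
  refine measure_congr ?_
  have h : ∀ᵐ s ∂ρ₁, s ∈ cdfInterior ρ₁ := measure_compl_cdfInterior ρ₁
  filter_upwards [h] with s hs
  exact propext (otMap_le_iff ρ₁ ρ₂ hs b)

/-- The square of the distance of two reals, as the area of a square; the indicator functions
separate the two points. -/
lemma enorm_sub_sq_eq_lintegral (x y : ℝ) :
    ‖x - y‖ₑ ^ 2 = ∫⁻ z : ℝ × ℝ,
      (if x ≤ min z.1 z.2 ∧ ¬ y ≤ max z.1 z.2 then 1 else 0) +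
      (if y ≤ min z.1 z.2 ∧ ¬ x ≤ max z.1 z.2 then 1 else 0) := by
  have key : ∀ x y : ℝ, ∫⁻ z : ℝ × ℝ, (if x ≤ min z.1 z.2 ∧ ¬ y ≤ max z.1 z.2 then 1 else 0) =
      ENNReal.ofReal (y - x) ^ 2 := by
    intro x y
    have : (fun z : ℝ × ℝ => if x ≤ min z.1 z.2 ∧ ¬ y ≤ max z.1 z.2 then (1 : ENNReal) else 0) =
        (Set.Ico x y ×ˢ Set.Ico x y).indicator 1 := by
      ext z
      have hiff : (x ≤ min z.1 z.2 ∧ ¬ y ≤ max z.1 z.2) ↔ z ∈ Set.Ico x y ×ˢ Set.Ico x y := by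
        simp only [le_min_iff, le_max_iff, Set.mem_prod, Set.mem_Ico]
        grind
      by_cases h : z ∈ Set.Ico x y ×ˢ Set.Ico x y
      · rw [if_pos (hiff.2 h), Set.indicator_of_mem h, Pi.one_apply]
      · rw [if_neg (fun h' => h (hiff.1 h')), Set.indicator_of_notMem h]
    rw [this, lintegral_indicator_one (measurableSet_Ico.prod measurableSet_Ico),
      Measure.volume_eq_prod, Measure.prod_prod, Real.volume_Ico, sq]
  rw [lintegral_add_left', key, key]
  · rcases le_total x y with h | h
    · rw [ENNReal.ofReal_of_nonpos (sub_nonpos.2 h), ← ofReal_norm, Real.norm_eq_abs,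
        abs_of_nonpos (sub_nonpos.2 h), neg_sub]
      simp
    · rw [ENNReal.ofReal_of_nonpos (sub_nonpos.2 h), ← ofReal_norm, Real.norm_eq_abs,
        abs_of_nonneg (sub_nonneg.2 h)]
      simp
  · refine Measurable.aemeasurable (Measurable.ite ?_ measurable_const measurable_const)
    exact (measurableSet_le measurable_const (measurable_fst.min measurable_snd)).inter
      (measurableSet_le measurable_const (measurable_fst.max measurable_snd)).compl

/-- If one of two events contains the other, then the probability of their difference is the
smallest one among all pairs of events with the same probabilities. -/
lemma measure_diff_le_of_nested {X Y : Type*} [MeasurableSpace X] [MeasurableSpace Y]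
    (ρ : Measure X) (π : Measure Y) [IsFiniteMeasure ρ] {A B : Set X} {A' B' : Set Y}
    (hA : MeasurableSet A) (hB : MeasurableSet B)
    (hAA : π A' = ρ A) (hBB : π B' = ρ B) (h : ρ (A \ B) = 0 ∨ ρ (B \ A) = 0) :
    ρ (A \ B) ≤ π (A' \ B') := by
  rcases h with h | h
  · rw [h]; exact zero_le
  · have h1 : ρ (A \ B) + ρ B = ρ A := by
      have h2 : ρ (A ∩ B) = ρ B := by
        have := measure_inter_add_sdiff (μ := ρ) B hA
        rw [h, add_zero, Set.inter_comm] at this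
        exact this
      rw [← measure_inter_add_sdiff A hB, h2, add_comm]
    have h3 : ρ (A \ B) + ρ B ≤ π (A' \ B') + ρ B := by
      rw [h1, ← hAA, ← hBB]
      calc π A' ≤ π ((A' \ B') ∪ B') := measure_mono (by intro z hz; by_cases z ∈ B' <;> simp_all)
        _ ≤ _ := measure_union_le _ _
    exact (ENNReal.add_le_add_iff_right (measure_ne_top ρ B)).1 h3

/-- The transport cost of a plan on the line, in terms of the measures of quadrants. -/
lemma cost_eq_lintegral_quadrants {X : Type*} [MeasurableSpace X] (π : Measure X)
    [SFinite π] (f g : X → ℝ) (hf : Measurable f) (hg : Measurable g) :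
    ∫⁻ w, ‖f w - g w‖ₑ ^ 2 ∂π = ∫⁻ z : ℝ × ℝ,
      π ({w | f w ≤ min z.1 z.2} \ {w | g w ≤ max z.1 z.2}) +
      π ({w | g w ≤ min z.1 z.2} \ {w | f w ≤ max z.1 z.2}) := by
  have hset : ∀ f g : X → ℝ, Measurable f → Measurable g →
      MeasurableSet {q : X × ℝ × ℝ | f q.1 ≤ min q.2.1 q.2.2 ∧ ¬ g q.1 ≤ max q.2.1 q.2.2} := by
    intro f g hf hg
    exact (measurableSet_le (hf.comp measurable_fst)
      ((measurable_fst.comp measurable_snd).min (measurable_snd.comp measurable_snd))).inter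
      (measurableSet_le (hg.comp measurable_fst)
      ((measurable_fst.comp measurable_snd).max (measurable_snd.comp measurable_snd))).compl
  simp_rw [enorm_sub_sq_eq_lintegral]
  rw [lintegral_lintegral_swap]
  · refine lintegral_congr fun z => ?_
    have hmeas : ∀ f g : X → ℝ, Measurable f → Measurable g →
        MeasurableSet {w | f w ≤ min z.1 z.2 ∧ ¬ g w ≤ max z.1 z.2} := fun f g hf hg =>
      (measurableSet_le hf measurable_const).inter (measurableSet_le hg measurable_const).compl
    have hind : ∀ f g : X → ℝ, Measurable f → Measurable g →
        ∫⁻ w, (if f w ≤ min z.1 z.2 ∧ ¬ g w ≤ max z.1 z.2 then 1 else 0) ∂π =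
          π ({w | f w ≤ min z.1 z.2} \ {w | g w ≤ max z.1 z.2}) := by
      intro f g hf hg
      have hset' : {w | f w ≤ min z.1 z.2} \ {w | g w ≤ max z.1 z.2} =
        {w | f w ≤ min z.1 z.2 ∧ ¬ g w ≤ max z.1 z.2} := rfl
      rw [hset', ← lintegral_indicator_one (hmeas f g hf hg)]
      refine lintegral_congr fun w => ?_
      simp [Set.indicator_apply]
    rw [lintegral_add_left (Measurable.ite (hmeas f g hf hg) measurable_const measurable_const),
      hind f g hf hg, hind g f hg hf]
  · exact ((Measurable.ite (hset f g hf hg) measurable_const measurable_const).add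
      (Measurable.ite (hset g f hg hf) measurable_const measurable_const)).aemeasurable

/-- Monotone maps are optimal for the quadratic cost on the line. No moment is assumed: quadrant
by quadrant, the plan of a monotone map charges the cost the least. -/
lemma lintegral_monotoneOn_le_cost (ρ : Measure ℝ) [IsProbabilityMeasure ρ] {t : ℝ → ℝ}
    (ht : Measurable t) {G : Set ℝ} (hG : ρ Gᶜ = 0) (hmono : MonotoneOn t G)
    {π : Measure (ℝ × ℝ)} (hπ : π ∈ couplings ρ (ρ.map t)) :
    ∫⁻ s, ‖s - t s‖ₑ ^ 2 ∂ρ ≤ cost π := by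
  obtain ⟨h1, h2⟩ := hπ
  have hπp : IsProbabilityMeasure π := by
    refine ⟨?_⟩
    have := congrArg (fun m => m Set.univ) h1
    simp only [measure_univ] at this
    rwa [Measure.map_apply measurable_fst MeasurableSet.univ, Set.preimage_univ] at this
  have hfst : ∀ p : ℝ, π {w | w.1 ≤ p} = ρ {s | s ≤ p} := fun p => by
    have := congrArg (fun m => m (Set.Iic p)) h1
    rwa [Measure.map_apply measurable_fst measurableSet_Iic] at this
  have hsnd : ∀ p : ℝ, π {w | w.2 ≤ p} = ρ {s | t s ≤ p} := fun p => by
    have := congrArg (fun m => m (Set.Iic p)) h2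
    rwa [Measure.map_apply measurable_snd measurableSet_Iic,
      Measure.map_apply ht measurableSet_Iic] at this
  have hm1 : ∀ p : ℝ, MeasurableSet {s : ℝ | s ≤ p} :=
    fun p => measurableSet_le measurable_id measurable_const
  have hm2 : ∀ p : ℝ, MeasurableSet {s : ℝ | t s ≤ p} :=
    fun p => measurableSet_le ht measurable_const
  unfold cost
  rw [cost_eq_lintegral_quadrants ρ (fun s => s) t measurable_id ht,
    cost_eq_lintegral_quadrants π Prod.fst Prod.snd measurable_fst measurable_snd]
  refine lintegral_mono fun z => add_le_add ?_ ?_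
  · refine measure_diff_le_of_nested ρ π (hm1 _) (hm2 _) (hfst _) (hsnd _) ?_
    by_cases h : ∃ s ∈ G, s ≤ min z.1 z.2 ∧ ¬ t s ≤ max z.1 z.2
    · obtain ⟨s₀, hs₀, hs1, hs2⟩ := h
      right
      refine measure_mono_null (t := Gᶜ) (fun s hs hsG => hs.2 ?_) hG
      by_contra hlt
      exact hs2 ((hmono hs₀ hsG (hs1.trans (not_le.1 hlt).le)).trans hs.1)
    · left
      refine measure_mono_null (t := Gᶜ) (fun s hs hsG => h ⟨s, hsG, hs.1, hs.2⟩) hG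
  · refine measure_diff_le_of_nested ρ π (hm2 _) (hm1 _) (hsnd _) (hfst _) ?_
    by_cases h : ∃ s ∈ G, t s ≤ min z.1 z.2 ∧ ¬ s ≤ max z.1 z.2
    · obtain ⟨s₀, hs₀, hs1, hs2⟩ := h
      right
      refine measure_mono_null (t := Gᶜ) (fun s hs hsG => hs.2 ?_) hG
      exact (hmono hsG hs₀ (hs.1.trans (not_le.1 hs2).le)).trans hs1
    · left
      refine measure_mono_null (t := Gᶜ) (fun s hs hsG => h ⟨s, hsG, hs.1, hs.2⟩) hG

/-- The plan induced by two maps bounds the Wasserstein distance of their laws. -/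
lemma W2sq_map_le {X Y : Type*} [NormedAddCommGroup X] [MeasurableSpace X] [BorelSpace X]
    [SecondCountableTopology X] [MeasurableSpace Y] (ρ : Measure Y) {f g : Y → X}
    (hf : Measurable f) (hg : Measurable g) :
    W2sq (ρ.map f) (ρ.map g) ≤ ∫⁻ y, ‖f y - g y‖ₑ ^ 2 ∂ρ := by
  have hfg := hf.prodMk hg
  have hmem : ρ.map (fun y => (f y, g y)) ∈ couplings (ρ.map f) (ρ.map g) := by
    constructor
    · rw [Measure.map_map measurable_fst hfg]; rfl
    · rw [Measure.map_map measurable_snd hfg]; rfl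
  refine (iInf₂_le _ hmem).trans (le_of_eq ?_)
  unfold cost
  rw [lintegral_map (f := fun z : X × X => ‖z.1 - z.2‖ₑ ^ 2)
    ((measurable_fst.sub measurable_snd).enorm.pow_const 2) hfg]

/-- The Wasserstein distance on the line, computed by the map `otMap`. -/
lemma W2sq_eq_otMap (ρ₁ ρ₂ : Measure ℝ) [IsProbabilityMeasure ρ₁] [NullSingletonClass ρ₁]
    [IsProbabilityMeasure ρ₂] :
    W2sq ρ₁ ρ₂ = ∫⁻ s, ‖s - otMap ρ₁ ρ₂ s‖ₑ ^ 2 ∂ρ₁ := by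
  apply le_antisymm
  · have h := W2sq_map_le ρ₁ measurable_id (measurable_otMap ρ₁ ρ₂)
    rwa [map_otMap, Measure.map_id] at h
  · refine le_iInf₂ fun π hπ => ?_
    refine lintegral_monotoneOn_le_cost ρ₁ (measurable_otMap _ _)
      (measure_compl_cdfInterior ρ₁) (monotoneOn_otMap ρ₁ ρ₂) ?_
    rwa [map_otMap]

/-! ### Measurability of the slice-matching map -/

lemma measurable_dir {d : ℕ} (i : Fin d) : Measurable fun P : Basis d => dir P i := by
  refine Continuous.measurable ?_
  refine (PiLp.continuous_toLp 2 _).comp (continuous_pi fun j => ?_)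
  exact (continuous_apply i).comp ((continuous_apply j).comp continuous_subtype_val)

lemma measurable_inner_right {d : ℕ} (θ : E d) : Measurable fun x : E d => inner ℝ θ x :=
  measurable_const.inner measurable_id

instance isProbabilityMeasure_proj {d : ℕ} (ν : Measure (E d)) [IsProbabilityMeasure ν]
    (θ : E d) : IsProbabilityMeasure (proj ν θ) :=
  Measure.isProbabilityMeasure_map (measurable_inner_right θ).aemeasurable

lemma cdf_proj {d : ℕ} (ν : Measure (E d)) [IsProbabilityMeasure ν] (θ : E d) (s : ℝ) :
    ProbabilityTheory.cdf (proj ν θ) s = ν.real {x | inner ℝ θ x ≤ s} := by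
  rw [ProbabilityTheory.cdf_eq_real, proj,
    map_measureReal_apply (measurable_inner_right θ) measurableSet_Iic]
  rfl

/-- The distribution functions of the projections depend measurably on the measure, on the
direction and on the point. -/
lemma measurable_cdf_proj {A : Type*} [MeasurableSpace A] {d : ℕ}
    (κ : ProbabilityTheory.Kernel A (E d)) [ProbabilityTheory.IsMarkovKernel κ] :
    Measurable fun z : A × E d × ℝ => ProbabilityTheory.cdf (proj (κ z.1) z.2.1) z.2.2 := by
  simp_rw [cdf_proj]
  refine Measurable.ennreal_toReal ?_
  let κ' : ProbabilityTheory.Kernel (A × E d × ℝ) (E d) := κ.comap Prod.fst measurable_fst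
  let T : Set ((A × E d × ℝ) × E d) := {w | inner ℝ w.1.2.1 w.2 ≤ w.1.2.2}
  have hT : MeasurableSet T := by
    refine measurableSet_le (Measurable.inner ?_ ?_) ?_ <;> fun_prop
  exact ProbabilityTheory.Kernel.measurable_kernel_prodMk_left (κ := κ') hT

lemma measurable_quantile_proj {d : ℕ} (μ : Measure (E d)) [IsProbabilityMeasure μ] :
    Measurable fun z : E d × ℝ => quantile (proj μ z.1) z.2 := by
  refine measurable_quantile (fun θ => proj μ θ) fun x => ?_
  have h := measurable_cdf_proj (ProbabilityTheory.Kernel.const Unit μ)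
  simp only [ProbabilityTheory.Kernel.const_apply] at h
  have hm : Measurable fun θ : E d => ((), θ, x) :=
    measurable_const.prodMk (measurable_id.prodMk measurable_const)
  have h' := h.comp hm
  simpa only [Function.comp_def] using h'

/-- The slice-matching map is jointly measurable in a parameter of the source measure, in the basis
and in the point. -/
lemma measurable_sliceMap {A : Type*} [MeasurableSpace A] {d : ℕ} (μ : Measure (E d))
    [IsProbabilityMeasure μ] (κ : ProbabilityTheory.Kernel A (E d))
    [ProbabilityTheory.IsMarkovKernel κ] :
    Measurable fun z : A × Basis d × E d => sliceMap μ (κ z.1) z.2.1 z.2.2 := by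
  unfold sliceMap
  refine Finset.measurable_fun_sum _ fun i _ => ?_
  have hdir : Measurable fun z : A × Basis d × E d => dir z.2.1 i :=
    (measurable_dir i).comp (measurable_fst.comp measurable_snd)
  have hx : Measurable fun z : A × Basis d × E d => z.2.2 := measurable_snd.comp measurable_snd
  have hm : Measurable fun z : A × Basis d × E d =>
      (z.1, dir z.2.1 i, inner ℝ (dir z.2.1 i) z.2.2) :=
    measurable_fst.prodMk (hdir.prodMk (hdir.inner hx))
  have hcdf := (measurable_cdf_proj κ).comp hm
  simp only [Function.comp_def] at hcdf
  have hq := (measurable_quantile_proj μ).comp (hdir.prodMk hcdf)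
  simp only [Function.comp_def] at hq
  exact hq.smul hdir

lemma measurable_sliceMap_prod {d : ℕ} (μ σ : Measure (E d)) [IsProbabilityMeasure μ]
    [IsProbabilityMeasure σ] :
    Measurable fun z : Basis d × E d => sliceMap μ σ z.1 z.2 := by
  have h := measurable_sliceMap μ (ProbabilityTheory.Kernel.const Unit σ)
  simp only [ProbabilityTheory.Kernel.const_apply] at h
  have hm : Measurable fun z : Basis d × E d => ((), z) := measurable_const.prodMk measurable_id
  have h' := h.comp hm
  simpa only [Function.comp_def] using h'

lemma measurable_sliceMap_right {d : ℕ} (μ σ : Measure (E d)) [IsProbabilityMeasure μ]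
    [IsProbabilityMeasure σ] (P : Basis d) : Measurable (sliceMap μ σ P) :=
  (measurable_sliceMap_prod μ σ).of_uncurry_left

/-! ### Columns of Haar distributed bases are uniform on the sphere -/

lemma orthonormal_dir {d : ℕ} (P : Basis d) : Orthonormal ℝ (dir P) := by
  rw [orthonormal_iff_ite]
  intro i j
  have h := congrFun (congrFun ((Matrix.mem_orthogonalGroup_iff' _ _).1 P.2) i) j
  rw [Matrix.mul_apply, Matrix.one_apply] at h
  rw [← h, PiLp.inner_apply]
  exact Finset.sum_congr rfl fun k _ => mul_comm _ _

/-- The columns of an orthogonal matrix, as an orthonormal basis. -/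
def basisOf {d : ℕ} (P : Basis d) : OrthonormalBasis (Fin d) ℝ (E d) :=
  OrthonormalBasis.mk (orthonormal_dir P) (by
    have hs := (orthonormal_dir P).linearIndependent.span_eq_top_of_card_eq_finrank'
      (by simp)
    exact hs.ge)

@[simp] lemma basisOf_apply {d : ℕ} (P : Basis d) (i : Fin d) : basisOf P i = dir P i := by
  simp [basisOf]

lemma exists_dir_eq {d : ℕ} (b : OrthonormalBasis (Fin d) ℝ (E d)) :
    ∃ Q : Basis d, ∀ i, dir Q i = b i := by
  refine ⟨⟨(EuclideanSpace.basisFun (Fin d) ℝ).toBasis.toMatrix b,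
    OrthonormalBasis.toMatrix_orthonormalBasis_mem_unitary _ _⟩, fun i => ?_⟩
  ext j
  simp [dir, Module.Basis.toMatrix_apply]

/-- The action of orthogonal matrices on the Euclidean space. -/
def act {d : ℕ} (Q : Basis d) : E d ≃ₗᵢ[ℝ] E d := (basisOf Q).repr.symm

lemma act_apply {d : ℕ} (Q : Basis d) (x : E d) : act Q x = ∑ j, x j • dir Q j := by
  rw [act, ← (basisOf Q).sum_repr_symm]
  simp

lemma act_dir {d : ℕ} (Q P : Basis d) (i : Fin d) : act Q (dir P i) = dir (Q * P) i := by
  rw [act_apply]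
  ext k
  simp [dir, Matrix.mul_apply, mul_comm]

lemma act_mul {d : ℕ} (Q R : Basis d) (x : E d) : act (Q * R) x = act Q (act R x) := by
  rw [act_apply R, map_sum, act_apply]
  simp [act_dir]

/-- Reflections show that orthogonal matrices act transitively on spheres. -/
lemma exists_act_eq {d : ℕ} {θ θ' : E d} (h : ‖θ‖ = ‖θ'‖) : ∃ Q : Basis d, act Q θ = θ' := by
  obtain ⟨Q, hQ⟩ := exists_dir_eq
    ((EuclideanSpace.basisFun (Fin d) ℝ).map (Submodule.reflection (ℝ ∙ (θ - θ'))ᗮ))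
  refine ⟨Q, ?_⟩
  rw [act_apply, ← Submodule.reflection_sub h]
  refine Eq.trans ?_ (congrArg (Submodule.reflection (ℝ ∙ (θ - θ'))ᗮ)
    ((EuclideanSpace.basisFun (Fin d) ℝ).sum_repr θ))
  simp only [hQ, OrthonormalBasis.map_apply, map_sum, map_smul, EuclideanSpace.basisFun_repr]

lemma measurable_act {d : ℕ} : Measurable fun z : Basis d × E d => act z.1 z.2 := by
  simp_rw [act_apply]
  refine Finset.measurable_fun_sum _ fun j _ => ?_
  have h1 : Measurable fun z : Basis d × E d => dir z.1 j := (measurable_dir j).comp measurable_fst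
  have h2 : Measurable fun z : Basis d × E d => z.2 j := by fun_prop
  exact h2.smul h1

/-- A rotation invariant probability measure on the sphere integrates a function to the average of
the function over an orbit. Only the left invariance of `ν` and transitivity are needed. -/
lemma lintegral_eq_orbit_average {d : ℕ} (ν : Measure (Basis d)) [IsProbabilityMeasure ν]
    [ν.IsMulLeftInvariant] (lam : Measure (E d)) [IsProbabilityMeasure lam]
    (hinv : ∀ Q : Basis d, lam.map (act Q) = lam) (hsph : ∀ᵐ θ ∂lam, ‖θ‖ = 1)
    {f : E d → ENNReal} (hf : Measurable f) {θ₀ : E d} (h₀ : ‖θ₀‖ = 1) :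
    ∫⁻ θ, f θ ∂lam = ∫⁻ Q, f (act Q⁻¹ θ₀) ∂ν := by
  have hconst : ∀ θ : E d, ‖θ‖ = 1 →
      ∫⁻ Q, f (act Q⁻¹ θ) ∂ν = ∫⁻ Q, f (act Q⁻¹ θ₀) ∂ν := by
    intro θ hθ
    obtain ⟨R, rfl⟩ := exists_act_eq (h₀.trans hθ.symm)
    rw [← lintegral_mul_left_eq_self (μ := ν) (fun Q => f (act Q⁻¹ (act R θ₀))) R]
    refine lintegral_congr fun Q => ?_
    rw [← act_mul, mul_inv_rev, inv_mul_cancel_right]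
  have hinvm : Measurable fun Q : Basis d => Q⁻¹ := continuous_inv.measurable
  have hpair : Measurable fun z : Basis d × E d => (z.1⁻¹, z.2) :=
    (hinvm.comp measurable_fst).prodMk measurable_snd
  have hm := hf.comp (measurable_act.comp hpair)
  simp only [Function.comp_def] at hm
  calc ∫⁻ θ, f θ ∂lam = ∫⁻ _Q, ∫⁻ θ, f θ ∂lam ∂ν := by simp
    _ = ∫⁻ Q : Basis d, ∫⁻ θ, f (act Q⁻¹ θ) ∂lam ∂ν := by
        refine lintegral_congr fun Q => ?_
        conv_lhs => rw [← hinv Q⁻¹]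
        rw [lintegral_map hf (act Q⁻¹).continuous.measurable]
    _ = ∫⁻ θ, ∫⁻ Q : Basis d, f (act Q⁻¹ θ) ∂ν ∂lam :=
        lintegral_lintegral_swap hm.aemeasurable
    _ = ∫⁻ _θ, ∫⁻ Q : Basis d, f (act Q⁻¹ θ₀) ∂ν ∂lam :=
        lintegral_congr_ae (hsph.mono fun θ hθ => hconst θ hθ)
    _ = ∫⁻ Q, f (act Q⁻¹ θ₀) ∂ν := by simp

open Pointwise in
lemma toSphere_map_act {d : ℕ} (Q : Basis d) :
    ((volume : Measure (E d)).toSphere.map Subtype.val).map (act Q) =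
      (volume : Measure (E d)).toSphere.map Subtype.val := by
  have hact : Measurable (act Q) := (act Q).continuous.measurable
  ext s hs
  rw [Measure.map_apply hact hs, Measure.map_apply measurable_subtype_coe (hact hs),
    Measure.map_apply measurable_subtype_coe hs,
    Measure.toSphere_apply' _ (measurable_subtype_coe (hact hs)),
    Measure.toSphere_apply' _ (measurable_subtype_coe hs)]
  congr 1
  have hpre : Set.Ioo (0 : ℝ) 1 • (Subtype.val '' ((Subtype.val : Metric.sphere (0 : E d) 1 → E d) ⁻¹'
      (act Q ⁻¹' s))) = act Q ⁻¹' (Set.Ioo (0 : ℝ) 1 •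
      (Subtype.val '' ((Subtype.val : Metric.sphere (0 : E d) 1 → E d) ⁻¹' s))) := by
    ext x
    simp only [Subtype.image_preimage_coe, Set.mem_smul, Set.mem_inter_iff, Set.mem_preimage]
    constructor
    · rintro ⟨r, hr, y, ⟨hy1, hy2⟩, rfl⟩
      exact ⟨r, hr, act Q y, ⟨by simpa using hy1, hy2⟩, by simp⟩
    · rintro ⟨r, hr, y, ⟨hy1, hy2⟩, hxy⟩
      refine ⟨r, hr, (act Q).symm y, ⟨by simpa using hy1, by simpa using hy2⟩, ?_⟩
      apply (act Q).injective
      simp [hxy]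
  rw [hpre]
  exact (LinearIsometryEquiv.measurePreserving (act Q)).measure_preimage_equiv
    (f := (act Q).toHomeomorph.toMeasurableEquiv) _

lemma isProbabilityMeasure_sphereUniform {d : ℕ} (hd : 1 ≤ d) :
    IsProbabilityMeasure (sphereUniform d) := by
  have : Nonempty (Fin d) := ⟨⟨0, hd⟩⟩
  have : Nontrivial (E d) := inferInstance
  refine ⟨?_⟩
  rw [sphereUniform, Measure.smul_apply, smul_eq_mul]
  refine ENNReal.inv_mul_cancel ?_ (measure_ne_top _ _)
  rw [ne_eq, Measure.measure_univ_eq_zero]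
  exact Measure.toSphere_ne_zero _

/-- The columns of a Haar distributed random orthonormal basis are uniform on the sphere. -/
lemma map_dir_eq_sphereUniform {d : ℕ} (ν : Measure (Basis d)) [IsProbabilityMeasure ν]
    [ν.IsMulLeftInvariant] (i : Fin d) :
    ν.map (fun P => dir P i) = (sphereUniform d).map Subtype.val := by
  have hU := isProbabilityMeasure_sphereUniform (d := d) (Nat.one_le_of_lt i.2)
  have hp1 : IsProbabilityMeasure (ν.map fun P => dir P i) :=
    Measure.isProbabilityMeasure_map (measurable_dir i).aemeasurable
  have hp2 : IsProbabilityMeasure ((sphereUniform d).map (Subtype.val : _ → E d)) :=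
    Measure.isProbabilityMeasure_map measurable_subtype_coe.aemeasurable
  have h₀ : ‖dir (1 : Basis d) i‖ = 1 := (orthonormal_dir 1).1 i
  refine Measure.ext_of_lintegral _ fun f hf => ?_
  rw [lintegral_eq_orbit_average ν _ ?_ ?_ hf h₀, lintegral_eq_orbit_average ν _ ?_ ?_ hf h₀]
  · intro Q
    rw [sphereUniform, Measure.map_smul, Measure.map_smul, toSphere_map_act]
  · rw [ae_map_iff measurable_subtype_coe.aemeasurable
      (measurableSet_eq_fun measurable_norm measurable_const)]
    exact Filter.Eventually.of_forall fun θ => by simp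
  · intro Q
    have hact : Measurable (act Q) := (act Q).continuous.measurable
    rw [Measure.map_map hact (measurable_dir i)]
    have hQ : (act Q) ∘ (fun P => dir P i) = (fun P => dir P i) ∘ (fun P => Q * P) := by
      ext1 P
      exact act_dir Q P i
    rw [hQ, ← Measure.map_map (measurable_dir i) (measurable_const_mul Q),
      map_mul_left_eq_self]
  · rw [ae_map_iff (measurable_dir i).aemeasurable
      (measurableSet_eq_fun measurable_norm measurable_const)]
    exact Filter.Eventually.of_forall fun P => (orthonormal_dir P).1 i

/-! ### Coordinates in an orthonormal basis -/

lemma inner_dir_sum {d : ℕ} (P : Basis d) (i : Fin d) (c : Fin d → ℝ) :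
    inner ℝ (dir P i) (∑ j, c j • dir P j) = c i :=
  (orthonormal_dir P).inner_right_fintype c i

lemma inner_dir_sliceMap {d : ℕ} (μ σ : Measure (E d)) (P : Basis d) (i : Fin d) (x : E d) :
    inner ℝ (dir P i) (sliceMap μ σ P x) =
      otMap (proj σ (dir P i)) (proj μ (dir P i)) (inner ℝ (dir P i) x) :=
  inner_dir_sum P i _

lemma enorm_sq_eq_ofReal {F : Type*} [SeminormedAddCommGroup F] (x : F) :
    ‖x‖ₑ ^ 2 = ENNReal.ofReal (‖x‖ ^ 2) := by
  rw [ENNReal.ofReal_pow (norm_nonneg _), ofReal_norm]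

lemma enorm_sq_eq_sum_inner {d : ℕ} (P : Basis d) (x : E d) :
    ‖x‖ₑ ^ 2 = ∑ i, ‖(inner ℝ (dir P i) x : ℝ)‖ₑ ^ 2 := by
  simp_rw [enorm_sq_eq_ofReal]
  rw [← ENNReal.ofReal_sum_of_nonneg fun i _ => sq_nonneg _]
  congr 1
  rw [← (basisOf P).sum_sq_norm_inner_right x]
  simp

/-- The coordinates of a vector in an orthonormal basis. -/
def coords {d : ℕ} (P : Basis d) : E d ≃ᵐ (Fin d → ℝ) :=
  (basisOf P).measurableEquiv.trans (MeasurableEquiv.toLp 2 (Fin d → ℝ)).symm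

@[simp] lemma coords_apply {d : ℕ} (P : Basis d) (x : E d) (i : Fin d) :
    coords P x i = inner ℝ (dir P i) x := by
  simp [coords, OrthonormalBasis.measurableEquiv, OrthonormalBasis.repr_apply_apply]

lemma measurePreserving_coords {d : ℕ} (P : Basis d) :
    MeasurePreserving (coords P) (volume : Measure (E d)) volume :=
  (EuclideanSpace.volume_preserving_symm_measurableEquiv_toLp (Fin d)).comp
    (basisOf P).measurePreserving_measurableEquiv

lemma map_eval_coords {d : ℕ} (σ : Measure (E d)) (P : Basis d) (i : Fin d) :
    (σ.map (coords P)).map (Function.eval i) = proj σ (dir P i) := by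
  rw [Measure.map_map (measurable_pi_apply i) (coords P).measurable, proj]
  congr 1
  ext x
  simp

lemma proj_absolutelyContinuous {d : ℕ} {σ : Measure (E d)} (hσ : σ ≪ volume) (P : Basis d)
    (i : Fin d) : proj σ (dir P i) ≪ volume := by
  rw [← map_eval_coords]
  have h := hσ.map (coords P).measurable
  rw [(measurePreserving_coords P).map_eq] at h
  exact (h.map (measurable_pi_apply i)).trans
    (Measure.quasiMeasurePreserving_eval (fun _ : Fin d => (volume : Measure ℝ)) i).absolutelyContinuous

lemma nullSingletonClass_proj {d : ℕ} {σ : Measure (E d)} (hσ : σ ≪ volume) (P : Basis d)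
    (i : Fin d) : NullSingletonClass (proj σ (dir P i)) :=
  ⟨fun x => proj_absolutelyContinuous hσ P i (measure_singleton x)⟩

/-! ### Push-forwards by slice-matching steps are absolutely continuous -/

lemma pi_absolutelyContinuous {n : ℕ} {X : Fin n → Type*} [∀ i, MeasurableSpace (X i)]
    {μ ν : ∀ i, Measure (X i)} [∀ i, SigmaFinite (μ i)] [∀ i, SigmaFinite (ν i)]
    (h : ∀ i, μ i ≪ ν i) : Measure.pi μ ≪ Measure.pi ν := by
  induction n with
  | zero => rw [Measure.pi_of_empty, Measure.pi_of_empty]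
  | succ n ih =>
    have h1 := (measurePreserving_piFinSuccAbove μ 0).symm.map_eq
    have h2 := (measurePreserving_piFinSuccAbove ν 0).symm.map_eq
    rw [← h1, ← h2]
    exact ((h 0).prod (ih fun i => h _)).map (MeasurableEquiv.measurable _)

/-- An absolutely continuous measure is absolutely continuous with respect to the product of its
marginals: the density vanishes where one of the marginal densities does. -/
lemma absolutelyContinuous_pi_marginals {n : ℕ} {σ : Measure (Fin n → ℝ)} [IsFiniteMeasure σ]
    (hσ : σ ≪ volume) : σ ≪ Measure.pi fun i => σ.map (Function.eval i) := by
  have hm : ∀ i, σ.map (Function.eval i) ≪ (volume : Measure ℝ) := fun i =>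
    (hσ.map (measurable_pi_apply i)).trans
      (Measure.quasiMeasurePreserving_eval (fun _ : Fin n => (volume : Measure ℝ)) i).absolutelyContinuous
  let f : Fin n → ℝ → ENNReal := fun i => (σ.map (Function.eval i)).rnDeriv volume
  let G : Fin n → Set ℝ := fun i => {s | f i s ≠ 0}
  have hf : ∀ i, Measurable (f i) := fun i => Measure.measurable_rnDeriv _ _
  have hG : ∀ i, MeasurableSet (G i) := fun i => (hf i (measurableSet_singleton 0)).compl
  have hdens : ∀ i, (volume : Measure ℝ).withDensity (f i) = σ.map (Function.eval i) :=
    fun i => Measure.withDensity_rnDeriv_eq _ _ (hm i)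
  have h1 : ∀ i, (volume : Measure ℝ).restrict (G i) ≪ σ.map (Function.eval i) := by
    intro i
    have h := withDensity_absolutelyContinuous' (μ := (volume : Measure ℝ).restrict (G i))
      (hf i).aemeasurable (ae_restrict_mem (hG i))
    rw [← restrict_withDensity (hG i), hdens] at h
    exact h.trans Measure.restrict_le_self.absolutelyContinuous
  have h2 : ∀ᵐ x ∂σ, x ∈ Set.univ.pi G := by
    have : ∀ i, ∀ᵐ x : Fin n → ℝ ∂σ, x i ∈ G i := by
      intro i
      refine ae_of_ae_map (f := (Function.eval i : (Fin n → ℝ) → ℝ)) (p := fun s : ℝ => s ∈ G i)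
        (measurable_pi_apply i).aemeasurable ?_
      rw [ae_iff, ← hdens]
      change (volume.withDensity (f i)) (G i)ᶜ = 0
      rw [withDensity_apply _ (hG i).compl]
      refine setLIntegral_eq_zero (hG i).compl fun s hs => ?_
      simpa [G] using hs
    filter_upwards [ae_all_iff.2 this] with x hx i _ using hx i
  have h3 := hσ.restrict (Set.univ.pi G)
  rw [Measure.restrict_eq_self_of_ae_mem h2, volume_pi, Measure.restrict_pi_pi] at h3
  exact h3.trans (pi_absolutelyContinuous h1)

/-- A map of the line that expands distances on a set of full measure preserves absolute
continuity. -/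
lemma map_absolutelyContinuous_of_expanding {ρ : Measure ℝ} (hρ : ρ ≪ volume) {s : ℝ → ℝ}
    (hs : Measurable s) {G : Set ℝ} (hG : ρ Gᶜ = 0) {K : NNReal}
    (hK : ∀ x ∈ G, ∀ y ∈ G, dist x y ≤ K * dist (s x) (s y)) : ρ.map s ≪ volume := by
  refine Measure.AbsolutelyContinuous.mk fun N hN hN0 => ?_
  rw [Measure.map_apply hs hN]
  have hinj : Set.InjOn s G := by
    intro x hx y hy hxy
    have h := hK x hx y hy
    rw [hxy, dist_self, mul_zero] at h
    exact dist_le_zero.1 h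
  have hlip : LipschitzOnWith K (Function.invFunOn s G) (s '' G) := by
    refine LipschitzOnWith.of_dist_le_mul ?_
    rintro _ ⟨x, hx, rfl⟩ _ ⟨y, hy, rfl⟩
    rw [hinj.leftInvOn_invFunOn hx, hinj.leftInvOn_invFunOn hy]
    exact hK x hx y hy
  have hnull : volume (Function.invFunOn s G '' (s '' G ∩ N)) = 0 := by
    have h := (hlip.mono Set.inter_subset_left).hausdorffMeasure_image_le (d := 1) zero_le_one
      (s := s '' G ∩ N)
    rw [hausdorffMeasure_real, measure_mono_null Set.inter_subset_right hN0, mul_zero] at h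
    exact le_antisymm h zero_le
  refine measure_mono_null (t := Gᶜ ∪ Function.invFunOn s G '' (s '' G ∩ N)) ?_
    (measure_union_null hG (hρ hnull))
  intro x hx
  by_cases hxG : x ∈ G
  · exact Or.inr ⟨s x, ⟨⟨x, hxG, rfl⟩, hx⟩, hinj.leftInvOn_invFunOn hxG⟩
  · exact Or.inl hxG

/-- The relaxation `(1 - γ) Id + γ t` of the transport map of an absolutely continuous measure to an
absolutely continuous target. For `γ < 1` it expands distances by at least `1 - γ`; for `γ = 1` the
push-forward is the target. -/
lemma map_relaxed_otMap_absolutelyContinuous {ρ₁ ρ₂ : Measure ℝ} [IsProbabilityMeasure ρ₁]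
    [IsProbabilityMeasure ρ₂] (h₁ : ρ₁ ≪ volume) (h₂ : ρ₂ ≪ volume) {γ : ℝ} (h0 : 0 ≤ γ)
    (h1 : γ ≤ 1) : ρ₁.map (fun s => (1 - γ) * s + γ * otMap ρ₁ ρ₂ s) ≪ volume := by
  have : NullSingletonClass ρ₁ := ⟨fun x => h₁ (measure_singleton x)⟩
  rcases h1.eq_or_lt with rfl | h1
  · simp only [sub_self, zero_mul, zero_add, one_mul]
    have h : ρ₁.map (fun s => otMap ρ₁ ρ₂ s) = ρ₂ := map_otMap ρ₁ ρ₂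
    rwa [h]
  · have hpos : 0 < 1 - γ := sub_pos.2 h1
    refine map_absolutelyContinuous_of_expanding h₁ (G := cdfInterior ρ₁)
      (K := ((1 - γ)⁻¹).toNNReal) ?_ (measure_compl_cdfInterior ρ₁) ?_
    · exact (measurable_const.mul measurable_id).add
        (measurable_const.mul (measurable_otMap ρ₁ ρ₂))
    · have key : ∀ x ∈ cdfInterior ρ₁, ∀ y ∈ cdfInterior ρ₁, x ≤ y →
          (1 - γ) * (y - x) ≤ ((1 - γ) * y + γ * otMap ρ₁ ρ₂ y) -
            ((1 - γ) * x + γ * otMap ρ₁ ρ₂ x) := by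
        intro x hx y hy hxy
        have := mul_le_mul_of_nonneg_left (monotoneOn_otMap ρ₁ ρ₂ hx hy hxy) h0
        linarith
      intro x hx y hy
      rw [Real.coe_toNNReal _ (inv_pos.2 hpos).le, ← div_eq_inv_mul, le_div_iff₀ hpos, mul_comm, Real.dist_eq, Real.dist_eq]
      rcases le_total x y with hxy | hxy
      · rw [abs_sub_comm, abs_of_nonneg (sub_nonneg.2 hxy), abs_sub_comm]
        exact (key x hx y hy hxy).trans (le_abs_self _)
      · rw [abs_of_nonneg (sub_nonneg.2 hxy)]
        exact (key y hy x hx hxy).trans (le_abs_self _)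

/-- The map `(1 - γ) Id + γ T_{σ,P}` of one step of the scheme. -/
def step {d : ℕ} (μ σ : Measure (E d)) (γ : ℝ) (P : Basis d) (x : E d) : E d :=
  (1 - γ) • x + γ • sliceMap μ σ P x

lemma measurable_step {d : ℕ} (μ σ : Measure (E d)) [IsProbabilityMeasure μ]
    [IsProbabilityMeasure σ] (γ : ℝ) (P : Basis d) : Measurable (step μ σ γ P) := by
  have h := measurable_sliceMap_right μ σ P
  unfold step
  fun_prop

lemma map_step_absolutelyContinuous {d : ℕ} {μ σ : Measure (E d)} [IsProbabilityMeasure μ]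
    [IsProbabilityMeasure σ] (hμ : μ ≪ volume) (hσ : σ ≪ volume) {γ : ℝ} (h0 : 0 ≤ γ)
    (h1 : γ ≤ 1) (P : Basis d) : σ.map (step μ σ γ P) ≪ volume := by
  let s : Fin d → ℝ → ℝ := fun i r =>
    (1 - γ) * r + γ * otMap (proj σ (dir P i)) (proj μ (dir P i)) r
  have hs : ∀ i, Measurable (s i) := fun i => (measurable_const.mul measurable_id).add
    (measurable_const.mul (measurable_otMap _ _))
  have hS : Measurable fun (x : Fin d → ℝ) i => s i (x i) :=
    measurable_pi_lambda _ fun i => (hs i).comp (measurable_pi_apply i)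
  -- in the coordinates of the basis, the step acts on each coordinate separately
  have hconj : step μ σ γ P = (coords P).symm ∘ (fun (x : Fin d → ℝ) i => s i (x i)) ∘ coords P := by
    ext1 x
    rw [Function.comp_apply, eq_comm, MeasurableEquiv.symm_apply_eq]
    ext i
    simp [s, step, inner_add_right, inner_smul_right, inner_dir_sliceMap]
  have hprob : IsProbabilityMeasure (σ.map (coords P)) :=
    Measure.isProbabilityMeasure_map (coords P).measurable.aemeasurable
  have hac := hσ.map (coords P).measurable
  rw [(measurePreserving_coords P).map_eq] at hac
  have h2 := (absolutelyContinuous_pi_marginals hac).map hS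
  rw [Measure.pi_map_pi fun i => (hs i).aemeasurable] at h2
  have h3 : (σ.map (coords P)).map (fun (x : Fin d → ℝ) i => s i (x i)) ≪ volume := by
    refine h2.trans ?_
    rw [volume_pi]
    refine pi_absolutelyContinuous fun i => ?_
    rw [map_eval_coords]
    exact map_relaxed_otMap_absolutelyContinuous (proj_absolutelyContinuous hσ P i)
      (proj_absolutelyContinuous hμ P i) h0 h1
  have h4 := h3.map (coords P).symm.measurable
  have hvol := ((measurePreserving_coords P).symm).map_eq
  rw [hvol, Measure.map_map hS (coords P).measurable,
    Measure.map_map (coords P).symm.measurable (hS.comp (coords P).measurable)] at h4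
  rwa [hconj]

/-! ### The loss as an average over bases -/

lemma lintegral_proj {d : ℕ} (ν : Measure (E d)) (θ : E d) {f : ℝ → ENNReal} (hf : Measurable f) :
    ∫⁻ s, f s ∂(proj ν θ) = ∫⁻ x, f (inner ℝ θ x) ∂ν :=
  lintegral_map hf (measurable_inner_right θ)

/-- The slice-matching map has the second moment of the target: each of its coordinates has the law
of the projection of the target. -/
lemma lintegral_enorm_sliceMap {d : ℕ} {μ σ : Measure (E d)} [IsProbabilityMeasure μ]
    [IsProbabilityMeasure σ] (hσ : σ ≪ volume) (P : Basis d) :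
    ∫⁻ x, ‖sliceMap μ σ P x‖ₑ ^ 2 ∂σ = ∫⁻ x, ‖x‖ₑ ^ 2 ∂μ := by
  have hsq : Measurable fun s : ℝ => ‖s‖ₑ ^ 2 := measurable_enorm.pow_const 2
  simp_rw [enorm_sq_eq_sum_inner P, inner_dir_sliceMap]
  rw [lintegral_finsetSum, lintegral_finsetSum]
  · refine Finset.sum_congr rfl fun i _ => ?_
    have := nullSingletonClass_proj hσ P i
    have hot := measurable_otMap (proj σ (dir P i)) (proj μ (dir P i))
    have h := lintegral_proj σ (dir P i) (hsq.comp hot)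
    simp only [Function.comp_def] at h
    rw [← lintegral_proj μ (dir P i) hsq, ← h, ← lintegral_map hsq hot, map_otMap]
  · exact fun i _ => hsq.comp (measurable_inner_right _)
  · exact fun i _ => (hsq.comp (measurable_otMap _ _)).comp (measurable_inner_right _)

lemma exists_dir_eq_of_norm_eq_one {d : ℕ} {θ : E d} (hθ : ‖θ‖ = 1) (i : Fin d) :
    ∃ P : Basis d, dir P i = θ := by
  obtain ⟨Q, hQ⟩ := exists_act_eq (((orthonormal_dir (1 : Basis d)).1 i).trans hθ.symm)
  exact ⟨Q * 1, by rw [← act_dir, hQ]⟩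

/-- The squared `L²(σ)`-distance of the projections of a map and of the transport map in direction
`θ`. -/
def sliceCost {d : ℕ} (μ σ : Measure (E d)) (S : E d → E d) (θ : E d) : ENNReal :=
  ∫⁻ x, ‖inner ℝ θ (S x) - otMap (proj σ θ) (proj μ θ) (inner ℝ θ x)‖ₑ ^ 2 ∂σ

lemma measurable_otMap_proj {d : ℕ} (μ σ : Measure (E d)) [IsProbabilityMeasure μ]
    [IsProbabilityMeasure σ] :
    Measurable fun z : E d × E d => otMap (proj σ z.1) (proj μ z.1) (inner ℝ z.1 z.2) := by
  have h := measurable_cdf_proj (ProbabilityTheory.Kernel.const Unit σ)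
  simp only [ProbabilityTheory.Kernel.const_apply] at h
  have hm : Measurable fun z : E d × E d => ((), z.1, (inner ℝ z.1 z.2 : ℝ)) :=
    measurable_const.prodMk (measurable_fst.prodMk (measurable_fst.inner measurable_snd))
  have hcdf := h.comp hm
  simp only [Function.comp_def] at hcdf
  have hq := (measurable_quantile_proj μ).comp (measurable_fst.prodMk hcdf)
  exact hq

lemma measurable_sliceCost {d : ℕ} (μ σ : Measure (E d)) [IsProbabilityMeasure μ]
    [IsProbabilityMeasure σ] {S : E d → E d} (hS : Measurable S) :
    Measurable (sliceCost μ σ S) := by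
  have h1 := measurable_otMap_proj μ σ
  have h2 : Measurable fun z : E d × E d => (inner ℝ z.1 (S z.2) : ℝ) :=
    measurable_fst.inner (hS.comp measurable_snd)
  exact ((h2.sub h1).enorm.pow_const 2).lintegral_prod_right'

lemma sum_sliceCost {d : ℕ} (μ σ : Measure (E d)) [IsProbabilityMeasure μ]
    [IsProbabilityMeasure σ] {S : E d → E d} (hS : Measurable S) (P : Basis d) :
    ∑ i, sliceCost μ σ S (dir P i) = ∫⁻ x, ‖S x - sliceMap μ σ P x‖ₑ ^ 2 ∂σ := by
  simp_rw [enorm_sq_eq_sum_inner P, inner_sub_right, inner_dir_sliceMap]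
  rw [lintegral_finsetSum]
  · rfl
  · intro i _
    have h1 := (measurable_otMap (proj σ (dir P i)) (proj μ (dir P i))).comp
      (measurable_inner_right (dir P i))
    have h2 := (measurable_inner_right (dir P i)).comp hS
    exact (h2.sub h1).enorm.pow_const 2

lemma W2sq_proj_map_le {d : ℕ} {μ σ : Measure (E d)} [IsProbabilityMeasure μ]
    [IsProbabilityMeasure σ] (hσ : σ ≪ volume) {S : E d → E d} (hS : Measurable S) (P : Basis d)
    (i : Fin d) :
    W2sq (proj (σ.map S) (dir P i)) (proj μ (dir P i)) ≤ sliceCost μ σ S (dir P i) := by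
  have := nullSingletonClass_proj hσ P i
  have hin := measurable_inner_right (dir P i)
  have hot := measurable_otMap (proj σ (dir P i)) (proj μ (dir P i))
  have h1 : proj (σ.map S) (dir P i) = σ.map fun x => inner ℝ (dir P i) (S x) :=
    Measure.map_map hin hS
  have h2 : proj μ (dir P i) =
      σ.map fun x => otMap (proj σ (dir P i)) (proj μ (dir P i)) (inner ℝ (dir P i) x) := by
    conv_lhs => rw [← map_otMap (proj σ (dir P i)) (proj μ (dir P i))]
    conv_lhs => enter [2]; rw [proj]
    exact Measure.map_map hot hin
  rw [h1]
  conv_lhs => rw [h2]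
  exact W2sq_map_le σ (hin.comp hS) (hot.comp hin)

lemma W2sq_proj_eq {d : ℕ} {μ σ : Measure (E d)} [IsProbabilityMeasure μ]
    [IsProbabilityMeasure σ] (hσ : σ ≪ volume) (P : Basis d) (i : Fin d) :
    W2sq (proj σ (dir P i)) (proj μ (dir P i)) = sliceCost μ σ id (dir P i) := by
  have := nullSingletonClass_proj hσ P i
  rw [W2sq_eq_otMap]
  exact lintegral_proj σ (dir P i)
    ((measurable_id.sub (measurable_otMap _ _)).enorm.pow_const 2)

lemma lintegral_sphere_sliceCost {d : ℕ} (ν : Measure (Basis d))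
    [IsProbabilityMeasure ν] [ν.IsMulLeftInvariant] (μ σ : Measure (E d)) [IsProbabilityMeasure μ]
    [IsProbabilityMeasure σ] {S : E d → E d} (hS : Measurable S) :
    d * ∫⁻ θ, sliceCost μ σ S (θ : E d) ∂(sphereUniform d) =
      ∫⁻ P, ∫⁻ x, ‖S x - sliceMap μ σ P x‖ₑ ^ 2 ∂σ ∂ν := by
  have hm := measurable_sliceCost μ σ hS
  simp_rw [← sum_sliceCost μ σ hS]
  rw [lintegral_finsetSum (f := fun i P => sliceCost μ σ S (dir P i)) _
    fun i _ => hm.comp (measurable_dir i)]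
  have h : ∀ i : Fin d, ∫⁻ P, sliceCost μ σ S (dir P i) ∂ν =
      ∫⁻ θ, sliceCost μ σ S (θ : E d) ∂(sphereUniform d) := by
    intro i
    rw [← lintegral_map hm (measurable_dir i), map_dir_eq_sphereUniform ν i,
      lintegral_map hm measurable_subtype_coe]
  simp [h]

/-- The sliced distance from a push-forward of `σ` to the target is at most the mean squared
distance to the slice-matching maps of `σ` itself. -/
lemma mul_SW2sq_map_le {d : ℕ} (hd : 1 ≤ d) (ν : Measure (Basis d))
    [IsProbabilityMeasure ν] [ν.IsMulLeftInvariant] {μ σ : Measure (E d)} [IsProbabilityMeasure μ]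
    [IsProbabilityMeasure σ] (hσ : σ ≪ volume) {S : E d → E d} (hS : Measurable S) :
    d * SW2sq (σ.map S) μ ≤ ∫⁻ P, ∫⁻ x, ‖S x - sliceMap μ σ P x‖ₑ ^ 2 ∂σ ∂ν := by
  rw [← lintegral_sphere_sliceCost ν μ σ hS]
  refine mul_le_mul_right (lintegral_mono fun θ => ?_) _
  obtain ⟨P, hP⟩ := exists_dir_eq_of_norm_eq_one (θ := (θ : E d)) (by simp) ⟨0, hd⟩
  rw [← hP]
  exact W2sq_proj_map_le hσ hS P _

lemma mul_SW2sq_eq {d : ℕ} (hd : 1 ≤ d) (ν : Measure (Basis d))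
    [IsProbabilityMeasure ν] [ν.IsMulLeftInvariant] {μ σ : Measure (E d)} [IsProbabilityMeasure μ]
    [IsProbabilityMeasure σ] (hσ : σ ≪ volume) :
    d * SW2sq σ μ = ∫⁻ P, ∫⁻ x, ‖x - sliceMap μ σ P x‖ₑ ^ 2 ∂σ ∂ν := by
  have h := lintegral_sphere_sliceCost ν μ σ measurable_id
  simp only [id_eq] at h
  rw [← h]
  congr 1
  refine lintegral_congr fun θ => ?_
  obtain ⟨P, hP⟩ := exists_dir_eq_of_norm_eq_one (θ := (θ : E d)) (by simp) ⟨0, hd⟩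
  rw [← hP]
  exact W2sq_proj_eq hσ P _

lemma loss_eq_half {d : ℕ} (μ σ : Measure (E d)) :
    loss μ σ = (d * SW2sq σ μ).toReal / 2 := by
  rw [loss, ENNReal.toReal_mul, ENNReal.toReal_natCast]
  ring

lemma loss_nonneg {d : ℕ} (μ σ : Measure (E d)) : 0 ≤ loss μ σ := by
  unfold loss
  positivity

/-! ### Square integrability -/

lemma IsP2.memLp_id {d : ℕ} {ν : Measure (E d)} (h : IsP2 ν) : MemLp (fun x : E d => x) 2 ν :=
  (memLp_two_iff_integrable_sq_norm measurable_id.aestronglyMeasurable).2 h.moment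

lemma lintegral_enorm_sq_eq {X F : Type*} [MeasurableSpace X] [NormedAddCommGroup F]
    {ρ : Measure X} {f : X → F} (hf : MemLp f 2 ρ) :
    ∫⁻ x, ‖f x‖ₑ ^ 2 ∂ρ = ENNReal.ofReal (∫ x, ‖f x‖ ^ 2 ∂ρ) := by
  rw [ofReal_integral_eq_lintegral_ofReal ((memLp_two_iff_integrable_sq_norm hf.1).1 hf)
    (Filter.Eventually.of_forall fun x => sq_nonneg _)]
  simp_rw [enorm_sq_eq_ofReal]

lemma memLp_two_of_lintegral_ne_top {X F : Type*} [MeasurableSpace X] [NormedAddCommGroup F]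
    {ρ : Measure X} {f : X → F} (hf : AEStronglyMeasurable f ρ)
    (h : ∫⁻ x, ‖f x‖ₑ ^ 2 ∂ρ ≠ ⊤) : MemLp f 2 ρ := by
  rw [memLp_two_iff_integrable_sq_norm hf]
  refine ⟨hf.norm.pow 2, ?_⟩
  rw [HasFiniteIntegral]
  refine lt_of_eq_of_lt (lintegral_congr fun x => ?_) (lt_top_iff_ne_top.2 h)
  simp

lemma memLp_sliceMap_right {d : ℕ} {μ σ : Measure (E d)} (hμ : IsP2 μ) (hσ : IsP2ac σ)
    (P : Basis d) : MemLp (sliceMap μ σ P) 2 σ := by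
  have := hμ.prob
  have := hσ.prob
  refine memLp_two_of_lintegral_ne_top
    (measurable_sliceMap_right μ σ P).aestronglyMeasurable ?_
  rw [lintegral_enorm_sliceMap hσ.ac, lintegral_enorm_sq_eq hμ.memLp_id]
  exact ENNReal.ofReal_ne_top

lemma integral_norm_sliceMap_sq {d : ℕ} {μ σ : Measure (E d)} (hμ : IsP2 μ) (hσ : IsP2ac σ)
    (P : Basis d) : ∫ x, ‖sliceMap μ σ P x‖ ^ 2 ∂σ = M2 μ := by
  have := hμ.prob
  have := hσ.prob
  have h := lintegral_enorm_sliceMap (μ := μ) hσ.ac P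
  rw [lintegral_enorm_sq_eq (memLp_sliceMap_right hμ hσ P), lintegral_enorm_sq_eq hμ.memLp_id,
    ENNReal.ofReal_eq_ofReal_iff] at h
  · exact h
  · positivity
  · positivity

lemma memLp_sliceMap_prod {d : ℕ} {μ σ : Measure (E d)} (hμ : IsP2 μ) (hσ : IsP2ac σ)
    (ν : Measure (Basis d)) [IsProbabilityMeasure ν] :
    MemLp (fun z : Basis d × E d => sliceMap μ σ z.1 z.2) 2 (ν.prod σ) := by
  have := hμ.prob
  have := hσ.prob
  have hm := measurable_sliceMap_prod μ σ
  refine memLp_two_of_lintegral_ne_top hm.aestronglyMeasurable ?_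
  rw [lintegral_prod _ (hm.enorm.pow_const 2).aemeasurable]
  simp only [lintegral_enorm_sliceMap hσ.ac, lintegral_const, measure_univ, mul_one]
  rw [lintegral_enorm_sq_eq hμ.memLp_id]
  exact ENNReal.ofReal_ne_top

lemma lintegral_lintegral_enorm_sub {d : ℕ} {μ σ : Measure (E d)} (hμ : IsP2 μ) (hσ : IsP2ac σ)
    (ν : Measure (Basis d)) [IsProbabilityMeasure ν] {S : E d → E d} (hS : Measurable S)
    (hS2 : MemLp S 2 σ) :
    ∫⁻ P, ∫⁻ x, ‖S x - sliceMap μ σ P x‖ₑ ^ 2 ∂σ ∂ν =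
      ENNReal.ofReal (∫ z, ‖S z.2 - sliceMap μ σ z.1 z.2‖ ^ 2 ∂(ν.prod σ)) := by
  have := hμ.prob
  have := hσ.prob
  have hm : Measurable fun z : Basis d × E d => S z.2 - sliceMap μ σ z.1 z.2 :=
    (hS.comp measurable_snd).sub (measurable_sliceMap_prod μ σ)
  have h := lintegral_enorm_sq_eq ((hS2.comp_snd ν).sub (memLp_sliceMap_prod hμ hσ ν))
  simp only [Pi.sub_apply] at h
  rw [← h, lintegral_prod _ (hm.enorm.pow_const 2).aemeasurable]

lemma loss_eq_integral {d : ℕ} (hd : 1 ≤ d) (ν : Measure (Basis d))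
    [IsProbabilityMeasure ν] [ν.IsMulLeftInvariant] {μ σ : Measure (E d)} (hμ : IsP2 μ)
    (hσ : IsP2ac σ) :
    loss μ σ = (∫ z, ‖z.2 - sliceMap μ σ z.1 z.2‖ ^ 2 ∂(ν.prod σ)) / 2 := by
  have := hμ.prob
  have := hσ.prob
  have h := lintegral_lintegral_enorm_sub hμ hσ ν measurable_id hσ.memLp_id
  simp only [id_eq] at h
  rw [loss_eq_half, mul_SW2sq_eq hd ν hσ.ac, h, ENNReal.toReal_ofReal (by positivity)]

lemma loss_map_le_integral {d : ℕ} (hd : 1 ≤ d) (ν : Measure (Basis d))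
    [IsProbabilityMeasure ν] [ν.IsMulLeftInvariant] {μ σ : Measure (E d)} (hμ : IsP2 μ)
    (hσ : IsP2ac σ) {S : E d → E d} (hS : Measurable S) (hS2 : MemLp S 2 σ) :
    loss μ (σ.map S) ≤ (∫ z, ‖S z.2 - sliceMap μ σ z.1 z.2‖ ^ 2 ∂(ν.prod σ)) / 2 := by
  have := hμ.prob
  have := hσ.prob
  rw [loss_eq_half]
  have h := mul_SW2sq_map_le hd ν (μ := μ) hσ.ac hS
  rw [lintegral_lintegral_enorm_sub hμ hσ ν hS hS2] at h
  have h' := ENNReal.toReal_mono ENNReal.ofReal_ne_top h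
  rw [ENNReal.toReal_ofReal (by positivity)] at h'
  linarith

lemma loss_le_M2_add {d : ℕ} (hd : 1 ≤ d) (ν : Measure (Basis d))
    [IsProbabilityMeasure ν] [ν.IsMulLeftInvariant] {μ σ : Measure (E d)} (hμ : IsP2 μ)
    (hσ : IsP2ac σ) : loss μ σ ≤ M2 σ + M2 μ := by
  have := hμ.prob
  have := hσ.prob
  have hx : MemLp (fun z : Basis d × E d => z.2) 2 (ν.prod σ) := hσ.memLp_id.comp_snd ν
  have hT := memLp_sliceMap_prod hμ hσ ν
  have hx' := (memLp_two_iff_integrable_sq_norm hx.1).1 hx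
  have hT' := (memLp_two_iff_integrable_sq_norm hT.1).1 hT
  have h1 : ∫ z : Basis d × E d, ‖z.2‖ ^ 2 ∂(ν.prod σ) = M2 σ := by
    rw [integral_prod _ hx']
    simp [M2]
  have h2 : ∫ z : Basis d × E d, ‖sliceMap μ σ z.1 z.2‖ ^ 2 ∂(ν.prod σ) = M2 μ := by
    rw [integral_prod _ hT']
    simp [integral_norm_sliceMap_sq hμ hσ]
  rw [loss_eq_integral hd ν hμ hσ, ← h1, ← h2, ← integral_add hx' hT', div_le_iff₀ two_pos,
    ← integral_mul_const]
  refine integral_mono ((memLp_two_iff_integrable_sq_norm (hx.sub hT).1).1 (hx.sub hT))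
    ((hx'.add hT').mul_const _) fun z => ?_
  have := parallelogram_law_with_norm ℝ z.2 (sliceMap μ σ z.1 z.2)
  simp only
  nlinarith [sq_nonneg ‖z.2 + sliceMap μ σ z.1 z.2‖]

/-! ### The mean displacement and the expected decrease of the loss -/

lemma integrable_inner_of_memLp {X F : Type*} [MeasurableSpace X] [NormedAddCommGroup F]
    [InnerProductSpace ℝ F] {ρ : Measure X} {f g : X → F} (hf : MemLp f 2 ρ) (hg : MemLp g 2 ρ) :
    Integrable (fun x => (inner ℝ (f x) (g x) : ℝ)) ρ := by
  have hf' := (memLp_two_iff_integrable_sq_norm hf.1).1 hf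
  have hg' := (memLp_two_iff_integrable_sq_norm hg.1).1 hg
  refine (hf'.add hg').mono' (hf.1.inner hg.1) (Filter.Eventually.of_forall fun x => ?_)
  rw [Real.norm_eq_abs]
  refine (abs_real_inner_le_norm _ _).trans ?_
  simp only [Pi.add_apply]
  nlinarith [sq_nonneg (‖f x‖ - ‖g x‖), sq_nonneg (‖f x‖ + ‖g x‖)]

lemma norm_integral_sq_le {X F : Type*} [MeasurableSpace X] [NormedAddCommGroup F]
    [InnerProductSpace ℝ F] [CompleteSpace F] {ρ : Measure X} [IsProbabilityMeasure ρ] {f : X → F}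
    (hf : MemLp f 2 ρ) : ‖∫ x, f x ∂ρ‖ ^ 2 ≤ ∫ x, ‖f x‖ ^ 2 ∂ρ := by
  have hi : Integrable f ρ := hf.integrable one_le_two
  have hf' := (memLp_two_iff_integrable_sq_norm hf.1).1 hf
  let c := ∫ x, f x ∂ρ
  have h0 : 0 ≤ ∫ x, ‖c - f x‖ ^ 2 ∂ρ := by positivity
  simp_rw [norm_sub_sq_real] at h0
  have hi' : Integrable (fun x => ‖c‖ ^ 2 - 2 * inner ℝ c (f x)) ρ :=
    (integrable_const _).sub ((hi.const_inner c).const_mul 2)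
  rw [integral_add hi' hf', integral_sub (integrable_const _) ((hi.const_inner c).const_mul 2), integral_const_mul,
    integral_inner hi, real_inner_self_eq_norm_sq] at h0
  simp only [integral_const, probReal_univ, one_smul] at h0
  change ‖c‖ ^ 2 ≤ _
  linarith

/-- The mean displacement `x - ∫ T_{σ,P}(x) dν(P)`. It represents the derivative of the loss along
perturbations of the identity, and dominates the Wasserstein gradient. -/
def meanDisplacement {d : ℕ} (ν : Measure (Basis d)) (μ σ : Measure (E d)) (x : E d) : E d :=
  ∫ P, (x - sliceMap μ σ P x) ∂ν

section

variable {d : ℕ} {μ σ : Measure (E d)} (hμ : IsP2 μ) (hσ : IsP2ac σ)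
  (ν : Measure (Basis d)) [IsProbabilityMeasure ν]

lemma measurable_displacement [IsProbabilityMeasure μ] [IsProbabilityMeasure σ] :
    Measurable fun z : Basis d × E d => z.2 - sliceMap μ σ z.1 z.2 :=
  measurable_snd.sub (measurable_sliceMap_prod μ σ)

lemma measurable_meanDisplacement [IsProbabilityMeasure μ] [IsProbabilityMeasure σ] :
    Measurable (meanDisplacement ν μ σ) :=
  ((measurable_displacement (μ := μ) (σ := σ)).stronglyMeasurable.integral_prod_left'
    (μ := ν)).measurable

include hμ hσ

lemma memLp_displacement :
    MemLp (fun z : Basis d × E d => z.2 - sliceMap μ σ z.1 z.2) 2 (ν.prod σ) := by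
  have := hμ.prob
  have := hσ.prob
  exact (hσ.memLp_id.comp_snd ν).sub (memLp_sliceMap_prod hμ hσ ν)

lemma memLp_displacement_slice :
    ∀ᵐ x ∂σ, MemLp (fun P => x - sliceMap μ σ P x) 2 ν := by
  have := hμ.prob
  have := hσ.prob
  have h := memLp_displacement hμ hσ ν
  filter_upwards [((memLp_two_iff_integrable_sq_norm h.1).1 h).prod_left_ae] with x hx
  have hm : Measurable fun P => x - sliceMap μ σ P x :=
    (measurable_displacement (μ := μ) (σ := σ)).comp (measurable_id.prodMk measurable_const)
  exact (memLp_two_iff_integrable_sq_norm hm.aestronglyMeasurable).2 hx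

lemma memLp_meanDisplacement : MemLp (meanDisplacement ν μ σ) 2 σ := by
  have := hμ.prob
  have := hσ.prob
  have h := memLp_displacement hμ hσ ν
  have hm := (measurable_meanDisplacement (μ := μ) (σ := σ) ν).aestronglyMeasurable (μ := σ)
  have h' := ((memLp_two_iff_integrable_sq_norm h.1).1 h).integral_prod_right
  refine (memLp_two_iff_integrable_sq_norm hm).2 (h'.mono' (hm.norm.pow 2) ?_)
  filter_upwards [memLp_displacement_slice hμ hσ ν] with x hx
  rw [Real.norm_of_nonneg (by positivity)]
  exact norm_integral_sq_le hx

lemma integral_inner_displacement {u : E d → E d} (hu : MemLp u 2 σ) :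
    ∫ z, inner ℝ (u z.2) (z.2 - sliceMap μ σ z.1 z.2) ∂(ν.prod σ) =
      ∫ x, inner ℝ (u x) (meanDisplacement ν μ σ x) ∂σ := by
  have := hμ.prob
  have := hσ.prob
  rw [integral_prod_symm _ (integrable_inner_of_memLp (hu.comp_snd ν)
    (memLp_displacement hμ hσ ν))]
  refine integral_congr_ae ?_
  filter_upwards [memLp_displacement_slice hμ hσ ν] with x hx
  exact integral_inner (hx.integrable one_le_two) (u x)

/-- The loss is semiconcave along perturbations of the identity, with the mean displacement as
derivative. -/
lemma loss_map_add_le (hd : 1 ≤ d) [ν.IsMulLeftInvariant] {u : E d → E d} (hum : Measurable u)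
    (hu : MemLp u 2 σ) :
    loss μ (σ.map fun x => x + u x) ≤ loss μ σ +
      ∫ x, inner ℝ (u x) (meanDisplacement ν μ σ x) ∂σ + (∫ x, ‖u x‖ ^ 2 ∂σ) / 2 := by
  have := hμ.prob
  have := hσ.prob
  have hw := memLp_displacement hμ hσ ν
  have hu' := hu.comp_snd ν
  have h1 := loss_map_le_integral hd ν hμ hσ (measurable_id.add hum) (hσ.memLp_id.add hu)
  have h2 : ∫ z : Basis d × E d, ‖u z.2‖ ^ 2 ∂(ν.prod σ) = ∫ x, ‖u x‖ ^ 2 ∂σ := by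
    rw [integral_prod _ ((memLp_two_iff_integrable_sq_norm hu'.1).1 hu')]
    simp
  have hexp : ∀ z : Basis d × E d, ‖z.2 + u z.2 - sliceMap μ σ z.1 z.2‖ ^ 2 =
      ‖u z.2‖ ^ 2 + 2 * inner ℝ (u z.2) (z.2 - sliceMap μ σ z.1 z.2) +
        ‖z.2 - sliceMap μ σ z.1 z.2‖ ^ 2 := by
    intro z
    rw [← norm_add_sq_real]
    congr 2
    abel
  have hi := integrable_inner_of_memLp hu' hw
  simp only [Pi.add_apply, id_eq, hexp] at h1
  have hi' : Integrable (fun z : Basis d × E d =>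
      ‖u z.2‖ ^ 2 + 2 * inner ℝ (u z.2) (z.2 - sliceMap μ σ z.1 z.2)) (ν.prod σ) :=
    ((memLp_two_iff_integrable_sq_norm hu'.1).1 hu').add (hi.const_mul 2)
  rw [integral_add hi' ((memLp_two_iff_integrable_sq_norm hw.1).1 hw),
    integral_add ((memLp_two_iff_integrable_sq_norm hu'.1).1 hu') (hi.const_mul 2),
    integral_const_mul, h2, integral_inner_displacement hμ hσ ν hu] at h1
  rw [loss_eq_integral hd ν hμ hσ]
  exact h1.trans (le_of_eq (by ring))

/-- Averaged over the basis, a step with step size `γ` decreases the loss by the squared norm of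
the mean displacement times `γ`, up to a multiplicative error of order `γ²`. -/
lemma integral_loss_step_le (hd : 1 ≤ d) [ν.IsMulLeftInvariant] (γ : ℝ)
    (hint : Integrable (fun Q => loss μ (σ.map (step μ σ γ Q))) ν) :
    ∫ Q, loss μ (σ.map (step μ σ γ Q)) ∂ν ≤
      (1 + γ ^ 2) * loss μ σ - γ * ∫ x, ‖meanDisplacement ν μ σ x‖ ^ 2 ∂σ := by
  have := hμ.prob
  have := hσ.prob
  have hw := memLp_displacement hμ hσ ν
  have hg := memLp_meanDisplacement hμ hσ ν
  have hw2 := (memLp_two_iff_integrable_sq_norm hw.1).1 hw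
  have hgw := integrable_inner_of_memLp (hg.comp_snd ν) hw
  have hpt : ∀ Q, loss μ (σ.map (step μ σ γ Q)) ≤ loss μ σ -
      γ * ∫ x, inner ℝ (meanDisplacement ν μ σ x) (x - sliceMap μ σ Q x) ∂σ +
      γ ^ 2 / 2 * ∫ x, ‖x - sliceMap μ σ Q x‖ ^ 2 ∂σ := by
    intro Q
    have hmQ : Measurable fun x => x - sliceMap μ σ Q x :=
      measurable_id.sub (measurable_sliceMap_right μ σ Q)
    have hQ2 : MemLp (fun x => x - sliceMap μ σ Q x) 2 σ :=
      hσ.memLp_id.sub (memLp_sliceMap_right hμ hσ Q)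
    have h := loss_map_add_le hμ hσ ν hd (hmQ.const_smul (-γ)) (hQ2.const_smul (-γ))
    have hstep : step μ σ γ Q = fun x => x + (-γ) • (x - sliceMap μ σ Q x) := by
      ext1 x
      simp only [step]
      module
    rw [hstep]
    refine h.trans (le_of_eq ?_)
    simp only [Pi.smul_apply, inner_smul_left, norm_smul, mul_pow]
    rw [integral_const_mul, integral_const_mul]
    simp only [real_inner_comm, conj_trivial, norm_neg, Real.norm_eq_abs, sq_abs]
    ring
  have hi1 : Integrable (fun Q => ∫ x, inner ℝ (meanDisplacement ν μ σ x)
      (x - sliceMap μ σ Q x) ∂σ) ν := hgw.integral_prod_left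
  have hi2 : Integrable (fun Q => ∫ x, ‖x - sliceMap μ σ Q x‖ ^ 2 ∂σ) ν := hw2.integral_prod_left
  have hi3 : Integrable (fun Q => loss μ σ - γ * ∫ x, inner ℝ (meanDisplacement ν μ σ x)
      (x - sliceMap μ σ Q x) ∂σ) ν := (integrable_const _).sub (hi1.const_mul γ)
  refine (integral_mono hint (hi3.add (hi2.const_mul (γ ^ 2 / 2))) hpt).trans (le_of_eq ?_)
  have e1 := integral_inner_displacement hμ hσ ν hg
  rw [integral_prod _ hgw] at e1
  have e2 := loss_eq_integral hd ν hμ hσ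
  rw [integral_prod _ hw2] at e2
  simp only [Pi.add_apply]
  rw [integral_add hi3 (hi2.const_mul _), integral_sub (integrable_const _) (hi1.const_mul γ),
    integral_const_mul, integral_const_mul, e1]
  simp only [integral_const, probReal_univ, one_smul, real_inner_self_eq_norm_sq]
  rw [e2]
  ring

end

/-! ### The mean displacement dominates the Wasserstein gradient -/

/-- A dual certificate of optimality: if `x` minimizes `‖· - S x‖² + Φ` for every `x`, then the plan
induced by `S` is optimal. -/
lemma lintegral_le_cost_of_dual {d : ℕ} {σ : Measure (E d)} {S : E d → E d} (hS : Measurable S)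
    {Φ : E d → ENNReal} (hΦ : Measurable Φ) (hfin : ∫⁻ x, Φ x ∂σ ≠ ⊤)
    (hmin : ∀ x x', ‖x - S x‖ₑ ^ 2 + Φ x ≤ ‖x' - S x‖ₑ ^ 2 + Φ x')
    {π : Measure (E d × E d)} (hπ : π ∈ couplings σ (σ.map S)) :
    ∫⁻ x, ‖x - S x‖ₑ ^ 2 ∂σ ≤ cost π := by
  let e : E d → ENNReal := fun y => ⨅ x', (‖x' - y‖ₑ ^ 2 + Φ x')
  have he : Measurable e := by
    refine UpperSemicontinuous.measurable (upperSemicontinuous_iInf fun x' => ?_)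
    refine Continuous.upperSemicontinuous ?_
    have : Continuous fun y : E d => ‖x' - y‖ₑ ^ 2 := by
      simp_rw [enorm_sq_eq_ofReal]
      exact ENNReal.continuous_ofReal.comp (by fun_prop)
    exact this.add continuous_const
  have heS : ∀ x, e (S x) = ‖x - S x‖ₑ ^ 2 + Φ x := fun x =>
    le_antisymm (iInf_le _ x) (le_iInf fun x' => hmin x x')
  have hΦ1 : ∫⁻ z, Φ z.1 ∂π = ∫⁻ x, Φ x ∂σ := by
    rw [← hπ.1, lintegral_map hΦ measurable_fst]
  have hcost : Measurable fun z : E d × E d => ‖z.1 - z.2‖ₑ ^ 2 :=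
    (measurable_fst.sub measurable_snd).enorm.pow_const 2
  have h : ∫⁻ x, ‖x - S x‖ₑ ^ 2 ∂σ + ∫⁻ x, Φ x ∂σ ≤ cost π + ∫⁻ x, Φ x ∂σ :=
    calc ∫⁻ x, ‖x - S x‖ₑ ^ 2 ∂σ + ∫⁻ x, Φ x ∂σ = ∫⁻ x, e (S x) ∂σ := by
          rw [← lintegral_add_right _ hΦ]
          exact lintegral_congr fun x => (heS x).symm
      _ = ∫⁻ z, e z.2 ∂π := by
          rw [← lintegral_map he hS, ← hπ.2, lintegral_map he measurable_snd]
      _ ≤ ∫⁻ z, (‖z.1 - z.2‖ₑ ^ 2 + Φ z.1) ∂π := lintegral_mono fun z => iInf_le _ z.1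
      _ = cost π + ∫⁻ x, Φ x ∂σ := by
          rw [lintegral_add_left hcost, hΦ1, cost]
  exact (ENNReal.add_le_add_iff_right hfin).1 h

/-- A quadratic lower bound of the first order Taylor remainder of a test function. -/
lemma exists_taylor_bound {d : ℕ} {ψ : E d → ℝ}
    (hψ : ContDiff ℝ ((⊤ : ℕ∞) : WithTop ℕ∞) ψ) (hc : HasCompactSupport ψ) :
    ∃ K : ℝ, 0 ≤ K ∧ ∀ x y, ψ x + inner ℝ (gradient ψ x) (y - x) - ψ y ≤ K * ‖y - x‖ ^ 2 := by
  have hf' : ContDiff ℝ 1 (fderiv ℝ ψ) := hψ.fderiv_right (by norm_cast)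
  obtain ⟨L, hL⟩ := hf'.lipschitzWith_of_hasCompactSupport (hc.fderiv (𝕜 := ℝ)) one_ne_zero
  refine ⟨L, L.2, fun x y => ?_⟩
  have hdiff : Differentiable ℝ ψ := hψ.differentiable (by simp)
  have h := (convex_segment x y).norm_image_sub_le_of_norm_fderiv_le' (𝕜 := ℝ) (f := ψ)
    (φ := fderiv ℝ ψ x) (C := L * ‖y - x‖) (fun z _ => hdiff z) (fun z hz => ?_)
    (left_mem_segment ℝ x y) (right_mem_segment ℝ x y)
  · have hin : fderiv ℝ ψ x (y - x) = inner ℝ (gradient ψ x) (y - x) := by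
      rw [← toDual_gradient, InnerProductSpace.toDual_apply_apply]
    rw [hin, Real.norm_eq_abs, abs_le] at h
    nlinarith [h.1]
  · rw [← dist_eq_norm]
    refine (hL.dist_le_mul z x).trans (mul_le_mul_of_nonneg_left ?_ L.2)
    obtain ⟨a, ha, rfl⟩ := (segment_eq_image' ℝ x y).subset hz
    rw [dist_eq_norm, add_sub_cancel_left, norm_smul, Real.norm_of_nonneg ha.1]
    exact mul_le_of_le_one_left (norm_nonneg _) ha.2

lemma continuous_gradient {d : ℕ} {ψ : E d → ℝ}
    (hψ : ContDiff ℝ ((⊤ : ℕ∞) : WithTop ℕ∞) ψ) : Continuous (gradient ψ) :=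
  (InnerProductSpace.toDual ℝ (E d)).symm.continuous.comp (hψ.continuous_fderiv (by simp))

lemma memLp_gradient {d : ℕ} {ψ : E d → ℝ}
    (hψ : ContDiff ℝ ((⊤ : ℕ∞) : WithTop ℕ∞) ψ) (hc : HasCompactSupport ψ)
    (σ : Measure (E d)) [IsFiniteMeasure σ] : MemLp (gradient ψ) 2 σ := by
  have hcg : HasCompactSupport (gradient ψ) :=
    hc.fderiv (𝕜 := ℝ) |>.comp_left (g := (InnerProductSpace.toDual ℝ (E d)).symm) (map_zero _)
  exact (continuous_gradient hψ).memLp_of_hasCompactSupport hcg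

/-- For small `t`, the map `Id + t ∇ψ` is an optimal transport map. -/
lemma map_add_gradient_mem_optimalCouplings {d : ℕ} {σ : Measure (E d)} [IsFiniteMeasure σ]
    {ψ : E d → ℝ} (hψ : ContDiff ℝ ((⊤ : ℕ∞) : WithTop ℕ∞) ψ) (hc : HasCompactSupport ψ)
    {K t : ℝ} (hK : ∀ x y, ψ x + inner ℝ (gradient ψ x) (y - x) - ψ y ≤ K * ‖y - x‖ ^ 2)
    (ht : 0 ≤ t) (htK : 2 * (t * K) ≤ 1) :
    σ.map (fun x => (x, x + t • gradient ψ x)) ∈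
        optimalCouplings σ (σ.map fun x => x + t • gradient ψ x) ∧
      W2sq σ (σ.map fun x => x + t • gradient ψ x) =
        ∫⁻ x, ‖t • gradient ψ x‖ₑ ^ 2 ∂σ := by
  have hg := continuous_gradient hψ
  have hS : Measurable fun x => x + t • gradient ψ x := (by fun_prop : Continuous _).measurable
  have hpair : Measurable fun x => (x, x + t • gradient ψ x) := measurable_id.prodMk hS
  obtain ⟨M, hM⟩ := hψ.continuous.bounded_above_of_compact_support hc
  have hMt : ∀ x, 0 ≤ 2 * t * (ψ x + M) := fun x => by
    have := neg_le_of_abs_le (hM x)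
    exact mul_nonneg (by positivity) (by linarith)
  have hcost : cost (σ.map (fun x => (x, x + t • gradient ψ x))) =
      ∫⁻ x, ‖t • gradient ψ x‖ₑ ^ 2 ∂σ := by
    unfold cost
    rw [lintegral_map (f := fun z : E d × E d => ‖z.1 - z.2‖ₑ ^ 2)
      ((measurable_fst.sub measurable_snd).enorm.pow_const 2) hpair]
    refine lintegral_congr fun x => ?_
    rw [sub_add_cancel_left, enorm_neg]
  have hcoup : σ.map (fun x => (x, x + t • gradient ψ x)) ∈
      couplings σ (σ.map fun x => x + t • gradient ψ x) := by
    constructor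
    · rw [Measure.map_map measurable_fst hpair]
      exact Measure.map_id
    · rw [Measure.map_map measurable_snd hpair]
      rfl
  have hopt : ∀ π ∈ couplings σ (σ.map fun x => x + t • gradient ψ x),
      ∫⁻ x, ‖t • gradient ψ x‖ₑ ^ 2 ∂σ ≤ cost π := by
    intro π hπ
    have hΦ : Measurable fun x => ENNReal.ofReal (2 * t * (ψ x + M)) :=
      ENNReal.measurable_ofReal.comp (by have := hψ.continuous; fun_prop)
    have hfin : ∫⁻ x, ENNReal.ofReal (2 * t * (ψ x + M)) ∂σ ≠ ⊤ := by
      refine ne_top_of_le_ne_top ?_ (lintegral_mono (g := fun _ => ENNReal.ofReal (2 * t * (M + M)))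
        fun x => ENNReal.ofReal_le_ofReal ?_)
      · rw [lintegral_const]
        exact ENNReal.mul_ne_top ENNReal.ofReal_ne_top (measure_ne_top _ _)
      · have := le_of_abs_le (hM x)
        exact mul_le_mul_of_nonneg_left (by linarith) (by positivity)
    have h := lintegral_le_cost_of_dual hS hΦ hfin (fun x x' => ?_) hπ
    · refine le_trans (le_of_eq (lintegral_congr fun x => ?_)) h
      rw [sub_add_cancel_left, enorm_neg]
    · rw [enorm_sq_eq_ofReal, enorm_sq_eq_ofReal, ← ENNReal.ofReal_add (by positivity) (hMt _),
        ← ENNReal.ofReal_add (by positivity) (hMt _)]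
      refine ENNReal.ofReal_le_ofReal ?_
      rw [sub_add_cancel_left, norm_neg, ← sub_sub, norm_sub_sq_real (x' - x), inner_smul_right,
        real_inner_comm]
      have h1 := mul_le_mul_of_nonneg_left (hK x x') ht
      have h2 := mul_le_mul_of_nonneg_right htK (sq_nonneg ‖x' - x‖)
      linarith
  have hW : W2sq σ (σ.map fun x => x + t • gradient ψ x) =
      ∫⁻ x, ‖t • gradient ψ x‖ₑ ^ 2 ∂σ :=
    le_antisymm ((iInf₂_le _ hcoup).trans hcost.le) (le_iInf₂ hopt)
  exact ⟨⟨hcoup, hcost.trans hW.symm⟩, hW⟩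

lemma IsP2.map {d : ℕ} {σ : Measure (E d)} (hσ : IsP2 σ) {S : E d → E d} (hS : Measurable S)
    (hS2 : MemLp S 2 σ) : IsP2 (σ.map S) := by
  have := hσ.prob
  refine ⟨Measure.isProbabilityMeasure_map hS.aemeasurable, ?_⟩
  have h := (memLp_two_iff_integrable_sq_norm hS2.1).1 hS2
  exact (integrable_map_measure (f := S) (g := fun x : E d => ‖x‖ ^ 2)
    (by fun_prop) hS.aemeasurable).2 h

/-- Testing the expansion that defines the Wasserstein gradient along `Id + t ∇ψ` against the
semiconcavity of the loss. -/
lemma integral_inner_gradient_le {d : ℕ} (hd : 1 ≤ d) (ν : Measure (Basis d))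
    [IsProbabilityMeasure ν] [ν.IsMulLeftInvariant] {μ σ : Measure (E d)} (hμ : IsP2 μ)
    (hσ : IsP2ac σ) {v : E d → E d} (hv : IsWassersteinGradient (loss μ) σ v) {ψ : E d → ℝ}
    (hψ : ContDiff ℝ ((⊤ : ℕ∞) : WithTop ℕ∞) ψ) (hc : HasCompactSupport ψ) :
    ∫ x, inner ℝ (v x) (gradient ψ x) ∂σ ≤
      ∫ x, inner ℝ (gradient ψ x) (meanDisplacement ν μ σ x) ∂σ := by
  have := hσ.prob
  obtain ⟨K, hK0, hK⟩ := exists_taylor_bound hψ hc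
  have hg := continuous_gradient hψ
  have hg2 := memLp_gradient hψ hc σ
  let N2 := ∫ x, ‖gradient ψ x‖ ^ 2 ∂σ
  have hN2 : 0 ≤ N2 := by positivity
  let N := Real.sqrt N2
  have hN : 0 ≤ N := Real.sqrt_nonneg _
  refine le_of_forall_pos_le_add fun ε₀ hε₀ => ?_
  -- the error terms add up to at most `ε (N + N2)`
  obtain ⟨ε, hε, hεle⟩ : ∃ ε > 0, ε * (N + N2) ≤ ε₀ := by
    refine ⟨ε₀ / (N + N2 + 1), by positivity, ?_⟩
    rw [div_mul_eq_mul_div, div_le_iff₀ (by positivity)]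
    nlinarith
  obtain ⟨δ, hδ, hexp⟩ := hv.2 ε hε
  obtain ⟨t, ht, htK, htN, htε⟩ : ∃ t > 0, 2 * (t * K) ≤ 1 ∧ t * N ≤ δ ∧ t ≤ ε := by
    refine ⟨min (1 / (2 * (K + 1))) (min (δ / (N + 1)) ε), by positivity, ?_, ?_, ?_⟩
    · have h : min (1 / (2 * (K + 1))) (min (δ / (N + 1)) ε) * K ≤ 1 / (2 * (K + 1)) * (K + 1) :=
        mul_le_mul (min_le_left _ _) (by linarith) hK0 (by positivity)
      have h' : 1 / (2 * (K + 1)) * (K + 1) = 1 / 2 := by field_simp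
      linarith
    · have h : min (1 / (2 * (K + 1))) (min (δ / (N + 1)) ε) * N ≤ δ / (N + 1) * (N + 1) :=
        mul_le_mul ((min_le_right _ _).trans (min_le_left _ _)) (by linarith) hN (by positivity)
      rwa [div_mul_cancel₀ _ (by positivity)] at h
    · exact (min_le_right _ _).trans (min_le_right _ _)
  have hS : Measurable fun x => x + t • gradient ψ x := (by fun_prop : Continuous _).measurable
  obtain ⟨hopt, hW2⟩ := map_add_gradient_mem_optimalCouplings (σ := σ) hψ hc hK ht.le htK
  have hW : W2 σ (σ.map fun x => x + t • gradient ψ x) = t * N := by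
    have h := lintegral_enorm_sq_eq (hg2.const_smul t)
    simp only [Pi.smul_apply] at h
    rw [W2, hW2, h, ENNReal.toReal_ofReal (by positivity)]
    simp_rw [norm_smul, mul_pow]
    rw [integral_const_mul, Real.sqrt_mul (by positivity), Real.sqrt_sq (norm_nonneg _),
      Real.norm_of_nonneg ht.le]
  have h := hexp _ (hσ.toIsP2.map hS (hσ.memLp_id.add (hg2.const_smul t)))
    (by rw [hW]; exact htN) _ hopt
  have hint : ∫ z, inner ℝ (v z.1) (z.2 - z.1) ∂(σ.map fun x => (x, x + t • gradient ψ x)) =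
      t * ∫ x, inner ℝ (v x) (gradient ψ x) ∂σ := by
    have hpair : Measurable fun x => (x, x + t • gradient ψ x) := measurable_id.prodMk hS
    rw [integral_map hpair.aemeasurable]
    · simp only [add_sub_cancel_left, inner_smul_right]
      rw [integral_const_mul]
    · have hv1 : AEStronglyMeasurable (fun z : E d × E d => v z.1)
          (σ.map fun x => (x, x + t • gradient ψ x)) := by
        refine AEStronglyMeasurable.comp_measurable (g := v) ?_ measurable_fst
        rw [hopt.1.1]
        exact hv.1.1.1
      exact hv1.inner (measurable_snd.sub measurable_fst).aestronglyMeasurable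
  have hup := loss_map_add_le hμ hσ ν hd (u := fun x => t • gradient ψ x)
    (by fun_prop : Continuous _).measurable (hg2.const_smul t)
  simp only [inner_smul_left, norm_smul, mul_pow, conj_trivial] at hup
  rw [integral_const_mul, integral_const_mul, Real.norm_of_nonneg ht.le] at hup
  rw [hint, hW] at h
  have h' := (abs_le.1 h).1
  have h1 : t * ∫ x, inner ℝ (v x) (gradient ψ x) ∂σ ≤
      t * (∫ x, inner ℝ (gradient ψ x) (meanDisplacement ν μ σ x) ∂σ + ε * (N + N2)) := by
    have h2 : t * (t * N2) ≤ t * (ε * N2) :=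
      mul_le_mul_of_nonneg_left (mul_le_mul_of_nonneg_right htε hN2) ht.le
    have h3 : 0 ≤ t * (t * N2) := by positivity
    change _ ≤ _ + _ + t ^ 2 * N2 / 2 at hup
    nlinarith
  exact (le_of_mul_le_mul_left h1 ht).trans (by linarith)

/-- The Wasserstein gradient of the loss is dominated by the mean displacement. By density of
gradients in the tangent space, the gradient is dominated by its inner product with the mean
displacement, and the Cauchy-Schwarz inequality applies. -/
lemma normSq_wassersteinGradient_le {d : ℕ} (hd : 1 ≤ d) (ν : Measure (Basis d))
    [IsProbabilityMeasure ν] [ν.IsMulLeftInvariant] {μ σ : Measure (E d)} (hμ : IsP2 μ)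
    (hσ : IsP2ac σ) :
    normSq σ (wassersteinGradient (loss μ) σ) ≤ ∫ x, ‖meanDisplacement ν μ σ x‖ ^ 2 ∂σ := by
  classical
  have := hσ.prob
  unfold wassersteinGradient
  split_ifs with hex
  swap
  · simp only [normSq, Pi.zero_apply, norm_zero]
    norm_num
    positivity
  have hv := hex.choose_spec
  set v := hex.choose
  have hg := memLp_meanDisplacement hμ hσ ν
  have hv2 := hv.1.1
  let V := hv2.toLp v
  let G := hg.toLp _
  have hinner : ∀ {f g : E d → E d} (hf : MemLp f 2 σ) (hg : MemLp g 2 σ),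
      inner ℝ (hf.toLp f) (hg.toLp g) = ∫ x, inner ℝ (f x) (g x) ∂σ := by
    intro f g hf hg
    rw [L2.inner_def]
    refine integral_congr_ae ?_
    filter_upwards [hf.coeFn_toLp, hg.coeFn_toLp] with x h1 h2
    rw [h1, h2]
  have hnorm : ∀ {f : E d → E d} (hf : MemLp f 2 σ), ‖hf.toLp f‖ ^ 2 = ∫ x, ‖f x‖ ^ 2 ∂σ := by
    intro f hf
    rw [← real_inner_self_eq_norm_sq, hinner]
    simp_rw [real_inner_self_eq_norm_sq]
  have hVG : ‖V‖ ^ 2 ≤ ‖V‖ * ‖G‖ := by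
    refine le_of_forall_pos_le_add fun ε₀ hε₀ => ?_
    obtain ⟨ε, hε, hεle⟩ : ∃ ε > 0, ε * (‖V‖ + ‖G‖) ≤ ε₀ := by
      refine ⟨ε₀ / (‖V‖ + ‖G‖ + 1), by positivity, ?_⟩
      rw [div_mul_eq_mul_div, div_le_iff₀ (by positivity)]
      nlinarith
    obtain ⟨ψ, hψ, hc, hψε⟩ := hv.1.2 (ENNReal.ofReal ε) (ENNReal.ofReal_pos.2 hε)
    have hu2 := memLp_gradient hψ hc σ
    let U := hu2.toLp _
    have hVU : ‖V - U‖ ≤ ε := by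
      have h : V - U = (hv2.sub hu2).toLp _ := (MemLp.toLp_sub hv2 hu2).symm
      rw [h, Lp.norm_toLp]
      exact ENNReal.toReal_le_of_le_ofReal hε.le hψε
    have h1 : inner ℝ V U ≤ inner ℝ U G := by
      rw [hinner, hinner]
      exact integral_inner_gradient_le hd ν hμ hσ hv hψ hc
    have h2 : inner ℝ V (V - U) ≤ ‖V‖ * ε :=
      (real_inner_le_norm _ _).trans (mul_le_mul_of_nonneg_left hVU (norm_nonneg _))
    have h3 : inner ℝ (U - V) G ≤ ε * ‖G‖ := by
      refine (real_inner_le_norm _ _).trans (mul_le_mul_of_nonneg_right ?_ (norm_nonneg _))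
      rwa [norm_sub_rev]
    have h4 := real_inner_le_norm V G
    rw [inner_sub_right, real_inner_self_eq_norm_sq] at h2
    rw [inner_sub_left] at h3
    nlinarith
  have hle : ‖V‖ ≤ ‖G‖ := by
    by_contra! hlt
    nlinarith [norm_nonneg G]
  rw [normSq, ← hnorm hv2, ← hnorm hg]
  exact pow_le_pow_left₀ (norm_nonneg _) hle 2

/-! ### The random iterates -/

lemma memLp_step {d : ℕ} {μ σ : Measure (E d)} (hμ : IsP2 μ) (hσ : IsP2ac σ) (γ : ℝ)
    (P : Basis d) : MemLp (step μ σ γ P) 2 σ :=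
  (hσ.memLp_id.const_smul (1 - γ)).add ((memLp_sliceMap_right hμ hσ P).const_smul γ)

lemma isP2ac_map_step {d : ℕ} {μ σ : Measure (E d)} (hμ : IsP2ac μ) (hσ : IsP2ac σ) {γ : ℝ}
    (h0 : 0 ≤ γ) (h1 : γ ≤ 1) (P : Basis d) : IsP2ac (σ.map (step μ σ γ P)) := by
  have := hμ.prob
  have := hσ.prob
  exact ⟨hσ.toIsP2.map (measurable_step μ σ γ P) (memLp_step hμ.toIsP2 hσ γ P),
    map_step_absolutelyContinuous hμ.ac hσ.ac h0 h1 P⟩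

lemma M2_map_step_le {d : ℕ} {μ σ : Measure (E d)} (hμ : IsP2 μ) (hσ : IsP2ac σ) {γ : ℝ}
    (h0 : 0 ≤ γ) (h1 : γ ≤ 1) (P : Basis d) :
    M2 (σ.map (step μ σ γ P)) ≤ (1 - γ) * M2 σ + γ * M2 μ := by
  have := hμ.prob
  have := hσ.prob
  have hT := memLp_sliceMap_right hμ hσ P
  have hT2 := (memLp_two_iff_integrable_sq_norm hT.1).1 hT
  have hS := memLp_step hμ hσ γ P
  rw [M2, integral_map (measurable_step μ σ γ P).aemeasurable (by fun_prop), M2,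
    ← integral_norm_sliceMap_sq hμ hσ P, ← integral_const_mul, ← integral_const_mul,
    ← integral_add (hσ.moment.const_mul _) (hT2.const_mul _)]
  refine integral_mono ((memLp_two_iff_integrable_sq_norm hS.1).1 hS)
    ((hσ.moment.const_mul _).add (hT2.const_mul _)) fun x => ?_
  have hn : ‖step μ σ γ P x‖ ≤ (1 - γ) * ‖x‖ + γ * ‖sliceMap μ σ P x‖ := by
    refine (norm_add_le _ _).trans (le_of_eq ?_)
    rw [norm_smul, norm_smul, Real.norm_of_nonneg h0, Real.norm_of_nonneg (sub_nonneg.2 h1)]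
  refine (pow_le_pow_left₀ (norm_nonneg _) hn 2).trans ?_
  have h2 := mul_nonneg (mul_nonneg h0 (sub_nonneg.2 h1))
    (sq_nonneg (‖x‖ - ‖sliceMap μ σ P x‖))
  nlinarith

lemma isP2ac_iterate {d : ℕ} {μ σ₀ : Measure (E d)} (hμ : IsP2ac μ) (hσ₀ : IsP2ac σ₀)
    {γ : ℕ → ℝ} (h0 : ∀ j, 0 ≤ γ j) (h1 : ∀ j, γ j ≤ 1) (Q : ℕ → Basis d) (k : ℕ) :
    IsP2ac (iterate μ σ₀ γ Q k) := by
  induction k with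
  | zero => exact hσ₀
  | succ k ih => exact isP2ac_map_step hμ ih (h0 k) (h1 k) (Q k)

/-- A bound of the second moments that is attained by one of the iterates is inherited by all
later ones. -/
lemma M2_iterate_le {d : ℕ} {μ σ₀ : Measure (E d)} (hμ : IsP2ac μ) (hσ₀ : IsP2ac σ₀)
    {γ : ℕ → ℝ} (h0 : ∀ j, 0 ≤ γ j) (h1 : ∀ j, γ j ≤ 1) (Q : ℕ → Basis d) {R : ℝ}
    (hR : M2 μ ≤ R) {j k : ℕ} (hj : M2 (iterate μ σ₀ γ Q j) ≤ R) (hjk : j ≤ k) :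
    M2 (iterate μ σ₀ γ Q k) ≤ R := by
  induction k, hjk using Nat.le_induction with
  | base => exact hj
  | succ k _ ih =>
    refine (M2_map_step_le hμ.toIsP2 (isP2ac_iterate hμ hσ₀ h0 h1 Q k) (h0 k) (h1 k) (Q k)).trans ?_
    have e1 := mul_le_mul_of_nonneg_left ih (sub_nonneg.2 (h1 k))
    have e2 := mul_le_mul_of_nonneg_left hR (h0 k)
    linarith

lemma iterate_congr {d : ℕ} (μ σ₀ : Measure (E d)) (γ : ℕ → ℝ) {Q Q' : ℕ → Basis d} {k : ℕ}
    (h : ∀ j < k, Q j = Q' j) : iterate μ σ₀ γ Q k = iterate μ σ₀ γ Q' k := by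
  induction k with
  | zero => rfl
  | succ k ih =>
    simp only [iterate]
    rw [ih fun j hj => h j (hj.trans k.lt_succ_self), h k k.lt_succ_self]

lemma measurable_map_step {A : Type*} [MeasurableSpace A] {d : ℕ} (μ : Measure (E d))
    [IsProbabilityMeasure μ] {τ : A → Measure (E d)} (hτm : Measurable τ)
    (hτ : ∀ a, IsProbabilityMeasure (τ a)) (γ : ℝ) :
    Measurable fun z : A × Basis d => (τ z.1).map (step μ (τ z.1) γ z.2) := by
  let κ : ProbabilityTheory.Kernel A (E d) := ⟨τ, hτm⟩
  have hκ : ProbabilityTheory.IsMarkovKernel κ := ⟨hτ⟩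
  have hS : Measurable fun w : (A × Basis d) × E d => step μ (τ w.1.1) γ w.1.2 w.2 := by
    have hm : Measurable fun w : (A × Basis d) × E d => (w.1.1, w.1.2, w.2) := by fun_prop
    have h := (measurable_sliceMap μ κ).comp hm
    have hκτ : ∀ a, κ a = τ a := fun _ => rfl
    simp only [Function.comp_def, hκτ] at h
    unfold step
    fun_prop
  refine Measure.measurable_of_measurable_coe _ fun s hs => ?_
  have hmap : ∀ z : A × Basis d, (τ z.1).map (step μ (τ z.1) γ z.2) s =
      τ z.1 (Prod.mk z ⁻¹' ((fun w : (A × Basis d) × E d => step μ (τ w.1.1) γ w.1.2 w.2) ⁻¹' s)) :=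
    fun z => Measure.map_apply (measurable_step μ (τ z.1) γ z.2) hs
  simp_rw [hmap]
  exact ProbabilityTheory.Kernel.measurable_kernel_prodMk_left
    (κ := κ.comap (Prod.fst : A × Basis d → A) measurable_fst) (hS hs)

lemma measurable_iterate {d : ℕ} {μ σ₀ : Measure (E d)} (hμ : IsP2ac μ) (hσ₀ : IsP2ac σ₀)
    {γ : ℕ → ℝ} (h0 : ∀ j, 0 ≤ γ j) (h1 : ∀ j, γ j ≤ 1) (k : ℕ) :
    Measurable fun Q : ℕ → Basis d => iterate μ σ₀ γ Q k := by
  have := hμ.prob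
  induction k with
  | zero => exact measurable_const
  | succ k ih =>
    have h := measurable_map_step μ ih (fun Q => (isP2ac_iterate hμ hσ₀ h0 h1 Q k).prob) (γ k)
    have hm : Measurable fun Q : ℕ → Basis d => (Q, Q k) :=
      measurable_id.prodMk (measurable_pi_apply k)
    have h' := h.comp hm
    simp only [Function.comp_def] at h'
    exact h'

/-- The loss depends measurably on the measure, along kernels with absolutely continuous values. -/
lemma measurable_loss {A : Type*} [MeasurableSpace A] {d : ℕ} (hd : 1 ≤ d) (ν : Measure (Basis d))
    [IsProbabilityMeasure ν] [ν.IsMulLeftInvariant] {μ : Measure (E d)} (hμ : IsP2 μ)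
    {τ : A → Measure (E d)} (hτm : Measurable τ) (hτ : ∀ a, IsP2ac (τ a)) :
    Measurable fun a => loss μ (τ a) := by
  have := hμ.prob
  let κ : ProbabilityTheory.Kernel A (E d) := ⟨τ, hτm⟩
  have hκ : ProbabilityTheory.IsMarkovKernel κ := ⟨fun a => (hτ a).prob⟩
  have hloss : ∀ a, loss μ (τ a) =
      (∫⁻ P, ∫⁻ x, ‖x - sliceMap μ (κ a) P x‖ₑ ^ 2 ∂(κ a) ∂ν).toReal / 2 := by
    intro a
    have := (hτ a).prob
    rw [loss_eq_half, mul_SW2sq_eq hd ν (hτ a).ac]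
    rfl
  simp_rw [hloss]
  refine (Measurable.ennreal_toReal ?_).div_const 2
  have hm : Measurable fun w : (A × Basis d) × E d => (w.1.1, w.1.2, w.2) := by fun_prop
  have h := (measurable_sliceMap μ κ).comp hm
  simp only [Function.comp_def] at h
  have h2 : Measurable fun w : (A × Basis d) × E d =>
      ‖w.2 - sliceMap μ (κ w.1.1) w.1.2 w.2‖ₑ ^ 2 := (measurable_snd.sub h).enorm.pow_const 2
  have h3 := h2.lintegral_kernel_prod_right'
    (κ := κ.comap (Prod.fst : A × Basis d → A) measurable_fst)
  exact Measurable.lintegral_prod_right' (f := fun z : A × Basis d =>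
    ∫⁻ x, ‖x - sliceMap μ (κ z.1) z.2 x‖ₑ ^ 2 ∂(κ z.1)) h3

/-! ### The expected decrease of the loss along the scheme -/

/-- The bases used before step `k`; later bases are replaced by the identity. -/
def history {d : ℕ} (k : ℕ) (Q : ℕ → Basis d) (j : ℕ) : Basis d := if j < k then Q j else 1

lemma iterate_history {d : ℕ} (μ σ₀ : Measure (E d)) (γ : ℕ → ℝ) (Q : ℕ → Basis d) (k : ℕ) :
    iterate μ σ₀ γ (history k Q) k = iterate μ σ₀ γ Q k :=
  iterate_congr μ σ₀ γ fun j hj => by simp [history, hj]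

lemma measurable_history {d : ℕ} {Ω : Type*} [MeasurableSpace Ω] {P : ℕ → Ω → Basis d}
    (hP : ∀ j, Measurable (P j)) (k : ℕ) : Measurable fun ω => history k fun j => P j ω := by
  refine measurable_pi_lambda _ fun j => ?_
  unfold history
  split_ifs
  · exact hP j
  · exact measurable_const

lemma indepFun_history {d : ℕ} {Ω : Type*} [MeasurableSpace Ω] {ℙ : Measure Ω}
    {P : ℕ → Ω → Basis d} (hP : ∀ j, Measurable (P j)) (hind : ProbabilityTheory.iIndepFun P ℙ)
    (k : ℕ) : ProbabilityTheory.IndepFun (fun ω => history k fun j => P j ω) (P k) ℙ := by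
  have h := hind.indepFun_finset (Finset.range k) {k} (by simp) hP
  let φ : (Finset.range k → Basis d) → ℕ → Basis d := fun q j =>
    if hj : j ∈ Finset.range k then q ⟨j, hj⟩ else 1
  have hφ : Measurable φ := by
    refine measurable_pi_lambda _ fun j => ?_
    by_cases hj : j ∈ Finset.range k
    · simp only [φ, hj, dite_true]
      exact measurable_pi_apply _
    · simp only [φ, hj, dite_false]
      exact measurable_const
  have h' := h.comp hφ (measurable_pi_apply (⟨k, by simp⟩ : ({k} : Finset ℕ)))
  convert h' using 1
  swap
  · rfl
  ext1 ω
  ext1 j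
  by_cases hj : j < k <;> simp [φ, history, hj]

section

variable {d : ℕ} (hd : 1 ≤ d) {μ σ₀ : Measure (E d)} (hμ : IsP2ac μ) (hσ₀ : IsP2ac σ₀)
  {γ : ℕ → ℝ} (h0 : ∀ j, 0 ≤ γ j) (h1 : ∀ j, γ j ≤ 1)
  {Ω : Type*} [MeasurableSpace Ω] {ℙ : Measure Ω} [IsProbabilityMeasure ℙ]
  {P : ℕ → Ω → Basis d} (hP : IsHaarSequence ℙ P)

include hd hμ hσ₀ h0 h1 hP

lemma measurable_loss_iterate (k : ℕ) :
    Measurable fun ω => loss μ (iterate μ σ₀ γ (fun j => P j ω) k) := by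
  have := hP.haar 0
  have : IsProbabilityMeasure (ℙ.map (P 0)) :=
    Measure.isProbabilityMeasure_map (hP.meas 0).aemeasurable
  refine measurable_loss hd (ℙ.map (P 0)) hμ.toIsP2
    (τ := fun ω => iterate μ σ₀ γ (fun j => P j ω) k) ?_
    fun ω => isP2ac_iterate hμ hσ₀ h0 h1 _ k
  exact (measurable_iterate hμ hσ₀ h0 h1 k).comp (measurable_pi_lambda _ hP.meas)

lemma loss_iterate_le {R : ℝ} {k : ℕ} {ω : Ω}
    (hR : M2 (iterate μ σ₀ γ (fun j => P j ω) k) ≤ R) :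
    loss μ (iterate μ σ₀ γ (fun j => P j ω) k) ≤ R + M2 μ := by
  have := hP.haar 0
  have : IsProbabilityMeasure (ℙ.map (P 0)) :=
    Measure.isProbabilityMeasure_map (hP.meas 0).aemeasurable
  have h := loss_le_M2_add hd (ℙ.map (P 0)) hμ.toIsP2
    (isP2ac_iterate hμ hσ₀ h0 h1 (fun j => P j ω) k)
  linarith

lemma integrable_loss_iterate (k : ℕ) :
    Integrable (fun ω => loss μ (iterate μ σ₀ γ (fun j => P j ω) k)) ℙ := by
  refine Integrable.of_bound
    (measurable_loss_iterate hd hμ hσ₀ h0 h1 hP k).aestronglyMeasurable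
    (max (M2 σ₀) (M2 μ) + M2 μ) (Filter.Eventually.of_forall fun ω => ?_)
  rw [Real.norm_of_nonneg (loss_nonneg _ _)]
  exact loss_iterate_le hd hμ hσ₀ h0 h1 hP
    (M2_iterate_le hμ hσ₀ h0 h1 _ (le_max_right _ _) (le_max_left _ _) (Nat.zero_le k))

/-- The expected decrease of the loss in one step, for any integrable lower bound `R` of the squared
norm of the Wasserstein gradient. The new basis is independent of the current iterate, so that it
can be averaged first. -/
lemma integral_loss_iterate_succ_le (k : ℕ) {R : Ω → ℝ} (hR : Integrable R ℙ)
    (hle : ∀ᵐ ω ∂ℙ, R ω ≤ normSq (iterate μ σ₀ γ (fun j => P j ω) k)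
      (wassersteinGradient (loss μ) (iterate μ σ₀ γ (fun j => P j ω) k))) :
    ∫ ω, loss μ (iterate μ σ₀ γ (fun j => P j ω) (k + 1)) ∂ℙ ≤
      (1 + γ k ^ 2) * ∫ ω, loss μ (iterate μ σ₀ γ (fun j => P j ω) k) ∂ℙ -
        γ k * ∫ ω, R ω ∂ℙ := by
  have := hμ.prob
  have := hP.haar k
  let ν := ℙ.map (P k)
  have hν : IsProbabilityMeasure ν := Measure.isProbabilityMeasure_map (hP.meas k).aemeasurable
  have hit : ∀ Q, IsP2ac (iterate μ σ₀ γ Q k) := fun Q => isP2ac_iterate hμ hσ₀ h0 h1 Q k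
  let Φ : (ℕ → Basis d) × Basis d → ℝ := fun z =>
    loss μ ((iterate μ σ₀ γ z.1 k).map (step μ (iterate μ σ₀ γ z.1 k) (γ k) z.2))
  have hΦac : ∀ z : (ℕ → Basis d) × Basis d,
      IsP2ac ((iterate μ σ₀ γ z.1 k).map (step μ (iterate μ σ₀ γ z.1 k) (γ k) z.2)) :=
    fun z => isP2ac_map_step hμ (hit z.1) (h0 k) (h1 k) z.2
  have hΦm : Measurable Φ := by
    exact measurable_loss hd ν hμ.toIsP2 (measurable_map_step μ
      (measurable_iterate hμ hσ₀ h0 h1 k) (fun Q => (hit Q).prob) (γ k)) hΦac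
  have hΦbd : ∀ z, ‖Φ z‖ ≤ max (M2 σ₀) (M2 μ) + M2 μ := by
    intro z
    rw [Real.norm_of_nonneg (loss_nonneg _ _)]
    refine (loss_le_M2_add hd ν hμ.toIsP2 (hΦac z)).trans (add_le_add_left ?_ _)
    have e1 := M2_iterate_le hμ hσ₀ h0 h1 z.1 (le_max_right (M2 σ₀) (M2 μ)) (j := 0)
      (le_max_left _ _) (Nat.zero_le k)
    have e2 := mul_le_mul_of_nonneg_left e1 (sub_nonneg.2 (h1 k))
    have e3 := mul_le_mul_of_nonneg_left (le_max_right (M2 σ₀) (M2 μ)) (h0 k)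
    refine (M2_map_step_le hμ.toIsP2 (hit z.1) (h0 k) (h1 k) z.2).trans ?_
    linarith
  have hH := measurable_history hP.meas k
  have hΦint : ∀ (ρ : Measure ((ℕ → Basis d) × Basis d)) [IsFiniteMeasure ρ], Integrable Φ ρ :=
    fun ρ _ => Integrable.of_bound hΦm.aestronglyMeasurable _ (Filter.Eventually.of_forall hΦbd)
  have hHp : IsProbabilityMeasure (ℙ.map fun ω => history k fun j => P j ω) :=
    Measure.isProbabilityMeasure_map hH.aemeasurable
  have hlaw : ℙ.map (fun ω => (history k fun j => P j ω, P k ω)) =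
      (ℙ.map fun ω => history k fun j => P j ω).prod ν :=
    (ProbabilityTheory.indepFun_iff_map_prod_eq_prod_map_map hH.aemeasurable
      (hP.meas k).aemeasurable).1 (indepFun_history hP.meas hP.indep k)
  have hfub := (hΦint ((ℙ.map fun ω => history k fun j => P j ω).prod ν)).integral_prod_left
  have hstep : ∫ ω, loss μ (iterate μ σ₀ γ (fun j => P j ω) (k + 1)) ∂ℙ =
      ∫ ω, ∫ Q, Φ (history k fun j => P j ω, Q) ∂ν ∂ℙ :=
    calc ∫ ω, loss μ (iterate μ σ₀ γ (fun j => P j ω) (k + 1)) ∂ℙ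
        = ∫ ω, Φ (history k fun j => P j ω, P k ω) ∂ℙ := by
          refine integral_congr_ae (Filter.Eventually.of_forall fun ω => ?_)
          simp only [Φ, iterate_history]
          rfl
      _ = ∫ z, Φ z ∂(ℙ.map fun ω => (history k fun j => P j ω, P k ω)) :=
          (integral_map (hH.prodMk (hP.meas k)).aemeasurable hΦm.aestronglyMeasurable).symm
      _ = ∫ h, ∫ Q, Φ (h, Q) ∂ν ∂(ℙ.map fun ω => history k fun j => P j ω) := by
          rw [hlaw, integral_prod _ (hΦint _)]
      _ = _ := integral_map hH.aemeasurable hfub.aestronglyMeasurable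
  have hint := integrable_loss_iterate hd hμ hσ₀ h0 h1 hP k
  rw [hstep, ← integral_const_mul, ← integral_const_mul,
    ← integral_sub (hint.const_mul _) (hR.const_mul _)]
  refine integral_mono_ae (hfub.comp_measurable hH)
    ((hint.const_mul _).sub (hR.const_mul _)) ?_
  filter_upwards [hle] with ω hω
  have hslice : Integrable (fun Q => Φ (history k fun j => P j ω, Q)) ν :=
    Integrable.of_bound (hΦm.comp measurable_prodMk_left).aestronglyMeasurable _
      (Filter.Eventually.of_forall fun Q => hΦbd _)
  simp only [Φ, iterate_history] at hslice ⊢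
  have e1 := integral_loss_step_le hμ.toIsP2 (hit fun j => P j ω) ν hd (γ k) hslice
  have e2 := normSq_wassersteinGradient_le hd ν hμ.toIsP2 (hit fun j => P j ω)
  have e3 := mul_le_mul_of_nonneg_left (hω.trans e2) (h0 k)
  linarith

end

/-! ### The rate of convergence -/

/-- A recursion with a free parameter `lam`. With the choice `lam = (2 α + 1) x ^ (α - 1)`, where
`x = k + s`, it becomes linear with coefficient at most `1 - 2 α / x`, which suffices for the rate
`2 α - 1`; the condition on `n` makes the residual of order `x ^ (-2 α)`. -/
lemma rate_of_recursion {α s K M : ℝ} {n : ℕ} (hα : 1 / 2 < α) (hα1 : α < 1) (hs : 1 ≤ s)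
    (hn : 2 * α - 1 ≤ n * (1 - α)) (hM : 0 ≤ M) {a : ℕ → ℝ} (ha : ∀ k, 0 ≤ a k)
    (ha1 : a 1 ≤ K)
    (hrec : ∀ k : ℕ, 1 ≤ k → ∀ lam : ℝ, 0 < lam →
      a (k + 1) ≤ (1 + (1 / ((k : ℝ) + s) ^ α) ^ 2) * a k -
        1 / ((k : ℝ) + s) ^ α * (lam * a k - M * lam ^ (n + 1)))
    {C : ℝ} (hC1 : K * (1 + s) ^ (2 * α - 1) ≤ C) (hC2 : 2 * (M * (2 * α + 1) ^ (n + 1)) ≤ C) :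
    ∀ k : ℕ, 1 ≤ k → a k ≤ C / ((k : ℝ) + s) ^ (2 * α - 1) := by
  set β := 2 * α - 1 with hβ
  have hβ0 : 0 < β := by linarith
  have hβ1 : β ≤ 1 := by linarith
  set D := M * (2 * α + 1) ^ (n + 1) with hD
  have hD0 : 0 ≤ D := by positivity
  intro k hk
  induction k, hk using Nat.le_induction with
  | base =>
    rw [le_div_iff₀ (by positivity), Nat.cast_one]
    exact (mul_le_mul_of_nonneg_right ha1 (by positivity)).trans hC1
  | succ k hk ih =>
    have hx1 : 1 ≤ (k : ℝ) + s := by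
      have : (0 : ℝ) ≤ k := k.cast_nonneg
      linarith
    have hk1 : ((k + 1 : ℕ) : ℝ) + s = ((k : ℝ) + s) + 1 := by push_cast; ring
    rw [hk1]
    have hr := hrec k hk
    generalize (k : ℝ) + s = x at hx1 ih hr ⊢
    have hx : 0 < x := by linarith
    have hX : 0 < x ^ β := Real.rpow_pos_of_pos hx _
    have hY : 0 < (x + 1) ^ β := Real.rpow_pos_of_pos (by linarith) _
    -- the choice of the parameter
    have hlam := hr ((2 * α + 1) * x ^ (α - 1)) (by positivity)
    have e1 : 1 / x ^ α * ((2 * α + 1) * x ^ (α - 1)) = (2 * α + 1) / x := by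
      rw [Real.rpow_sub_one hx.ne']
      have := (Real.rpow_pos_of_pos hx α).ne'
      field_simp
    have e2 : (1 / x ^ α) ^ 2 ≤ 1 / x := by
      rw [div_pow, one_pow, ← Real.rpow_natCast, ← Real.rpow_mul hx.le]
      refine one_div_le_one_div_of_le hx ?_
      refine Real.self_le_rpow_of_one_le hx1 ?_
      push_cast
      linarith
    have e3 : 1 / x ^ α * (M * ((2 * α + 1) * x ^ (α - 1)) ^ (n + 1)) ≤ D / (x * x ^ β) := by
      have h1 : 1 / x ^ α * (M * ((2 * α + 1) * x ^ (α - 1)) ^ (n + 1)) =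
          D / x * (x ^ (α - 1)) ^ n := by
        calc _ = M * (1 / x ^ α * ((2 * α + 1) * x ^ (α - 1))) *
              ((2 * α + 1) * x ^ (α - 1)) ^ n := by ring
          _ = _ := by rw [e1, hD, mul_pow]; ring
      have h2 : (x ^ (α - 1)) ^ n ≤ 1 / x ^ β := by
        rw [← Real.rpow_natCast, ← Real.rpow_mul hx.le, one_div, ← Real.rpow_neg hx.le]
        refine Real.rpow_le_rpow_of_exponent_le hx1 ?_
        linarith
      rw [h1]
      refine (mul_le_mul_of_nonneg_left h2 (by positivity)).trans (le_of_eq ?_)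
      field_simp
    have hrec' : a (k + 1) ≤ (1 - (β + 1) / x) * a k + D / (x * x ^ β) := by
      have h1 : (1 + (1 / x ^ α) ^ 2) * a k ≤ (1 + 1 / x) * a k :=
        mul_le_mul_of_nonneg_right (by linarith) (ha k)
      have h2 : 1 / x ^ α * ((2 * α + 1) * x ^ (α - 1) * a k -
          M * ((2 * α + 1) * x ^ (α - 1)) ^ (n + 1)) =
          (2 * α + 1) / x * a k - 1 / x ^ α * (M * ((2 * α + 1) * x ^ (α - 1)) ^ (n + 1)) := by
        rw [← e1]; ring
      have h3 : (1 + 1 / x) * a k - (2 * α + 1) / x * a k = (1 - (β + 1) / x) * a k := by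
        rw [hβ]; field_simp; ring
      linarith
    -- Bernoulli's inequality compares consecutive values of the rate
    have hbern : (x + 1) ^ β ≤ x ^ β * (1 + β / x) := by
      have h1 : x + 1 = x * (1 + 1 / x) := by field_simp
      rw [h1, Real.mul_rpow hx.le (by positivity)]
      refine mul_le_mul_of_nonneg_left ?_ hX.le
      have h2 := rpow_one_add_le_one_add_mul_self (s := 1 / x)
        (by have : 0 < 1 / x := by positivity
            linarith) hβ0.le hβ1
      rwa [mul_one_div] at h2
    have hC0 : 0 ≤ C := le_trans (by positivity) hC2
    have hβx : 0 ≤ β / x := by positivity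
    rw [le_div_iff₀ hY]
    rcases le_total 0 (1 - (β + 1) / x) with hpos | hneg
    · have h1 : a (k + 1) ≤ C / x ^ β * (1 - β / x) := by
        have h2 := mul_le_mul_of_nonneg_left ih hpos
        have h3 : D / (x * x ^ β) ≤ C / (x * x ^ β) :=
          div_le_div_of_nonneg_right (by linarith) (by positivity)
        have h4 : (1 - (β + 1) / x) * (C / x ^ β) + C / (x * x ^ β) = C / x ^ β * (1 - β / x) := by
          field_simp
          ring
        linarith
      have h5 : 0 ≤ C / x ^ β * (1 - β / x) := (ha _).trans h1
      calc a (k + 1) * (x + 1) ^ β ≤ C / x ^ β * (1 - β / x) * (x ^ β * (1 + β / x)) :=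
            mul_le_mul h1 hbern hY.le h5
        _ = C * (1 - (β / x) ^ 2) := by field_simp; ring
        _ ≤ C := mul_le_of_le_one_right hC0 (by nlinarith)
    · have h1 : a (k + 1) ≤ D / x ^ β := by
        have h3 : D / (x * x ^ β) ≤ D / x ^ β :=
          div_le_div_of_nonneg_left hD0 hX (le_mul_of_one_le_left hX.le hx1)
        have h4 := mul_nonpos_of_nonpos_of_nonneg hneg (ha k)
        linarith
      have hβx1 : β / x ≤ 1 := (div_le_one hx).2 (by linarith)
      calc a (k + 1) * (x + 1) ^ β ≤ D / x ^ β * (x ^ β * (1 + β / x)) :=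
            mul_le_mul h1 hbern hY.le (by positivity)
        _ = D * (1 + β / x) := by field_simp
        _ ≤ D * 2 := mul_le_mul_of_nonneg_left (by linarith) hD0
        _ ≤ C := by linarith

/-! ### Recursions from the Łojasiewicz inequality -/

/-- For `τ = 1`, the Łojasiewicz inequality bounds the squared norm of the gradient from below by
`F / B`, hence by an expression in which only positive moments of `B` enter. -/
lemma mul_sub_le_of_le_mul {F B G lam : ℝ} (n : ℕ) (hF : 0 ≤ F) (hB : 0 < B) (hlam : 0 < lam)
    (h : F ≤ B * G) : lam * F - lam ^ (n + 1) * (F * B ^ n) ≤ G := by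
  have hG : 0 ≤ G := nonneg_of_mul_nonneg_right (hF.trans h) hB
  rcases le_total (lam * B) 1 with h1 | h1
  · have h2 : lam * F ≤ lam * (B * G) := mul_le_mul_of_nonneg_left h hlam.le
    have h3 : lam * B * G ≤ G := mul_le_of_le_one_left hG h1
    have h4 : 0 ≤ lam ^ (n + 1) * (F * B ^ n) := by positivity
    nlinarith
  · have h2 : lam * F ≤ lam * F * (lam * B) ^ n :=
      le_mul_of_one_le_right (by positivity) (one_le_pow₀ h1)
    have h3 : lam ^ (n + 1) * (F * B ^ n) = lam * F * (lam * B) ^ n := by ring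
    linarith

/-- The counterpart for `τ = 2`, by completing the square. -/
lemma mul_sub_le_of_sq_le_mul {F B G lam : ℝ} (hB : 0 < B) (h : F ^ 2 ≤ B * G) :
    lam * F - lam ^ 2 / 4 * B ≤ G := by
  have h1 : B * (lam * F - lam ^ 2 / 4 * B) ≤ B * G := by
    nlinarith [sq_nonneg (F - lam / 2 * B)]
  exact le_of_mul_le_mul_left h1 hB

section

variable {d : ℕ} (hd : 1 ≤ d) {μ σ₀ : Measure (E d)} (hμ : IsP2ac μ) (hσ₀ : IsP2ac σ₀)
  {γ : ℕ → ℝ} (h0 : ∀ j, 0 ≤ γ j) (h1 : ∀ j, γ j ≤ 1)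
  {Ω : Type*} [MeasurableSpace Ω] {ℙ : Measure Ω} [IsProbabilityMeasure ℙ]
  {P : ℕ → Ω → Basis d} (hP : IsHaarSequence ℙ P) {B : ℕ → Ω → ℝ} {c : ℕ → ℝ}

include hd hμ hσ₀ h0 h1 hP

lemma recursion_of_lojasiewicz_one {K : ℝ} {n k : ℕ} (hn : 1 ≤ n) (hk : 1 ≤ k) (hK0 : 0 ≤ K)
    (hK : ∀ ω, loss μ (iterate μ σ₀ γ (fun j => P j ω) k) ≤ K)
    (hL : LojasiewiczAlong ℙ μ (fun k ω => iterate μ σ₀ γ (fun j => P j ω) k) 1 B c)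
    {lam : ℝ} (hlam : 0 < lam) :
    ∫ ω, loss μ (iterate μ σ₀ γ (fun j => P j ω) (k + 1)) ∂ℙ ≤
      (1 + γ k ^ 2) * ∫ ω, loss μ (iterate μ σ₀ γ (fun j => P j ω) k) ∂ℙ -
        γ k * (lam * ∫ ω, loss μ (iterate μ σ₀ γ (fun j => P j ω) k) ∂ℙ -
          K * c n * lam ^ (n + 1)) := by
  set F : Ω → ℝ := fun ω => loss μ (iterate μ σ₀ γ (fun j => P j ω) k) with hFdef
  have hFi : Integrable F ℙ := integrable_loss_iterate hd hμ hσ₀ h0 h1 hP k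
  have hF0 : ∀ ω, 0 ≤ F ω := fun ω => loss_nonneg _ _
  obtain ⟨hBi, hBc⟩ := hL.moment k hk n hn
  have hFB : Integrable (fun ω => F ω * B k ω ^ n) ℙ := by
    refine hBi.bdd_mul hFi.1 (c := K) (Filter.Eventually.of_forall fun ω => ?_)
    rw [Real.norm_of_nonneg (hF0 ω)]
    exact hK ω
  have hFBle : ∫ ω, F ω * B k ω ^ n ∂ℙ ≤ K * c n := by
    refine le_trans ?_ (mul_le_mul_of_nonneg_left hBc hK0)
    rw [← integral_const_mul]
    refine integral_mono_ae hFB (hBi.const_mul K) ?_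
    filter_upwards [hL.pos k hk] with ω hω
    exact mul_le_mul_of_nonneg_right (hK ω) (by positivity)
  have h := integral_loss_iterate_succ_le hd hμ hσ₀ h0 h1 hP k
    (R := fun ω => lam * F ω - lam ^ (n + 1) * (F ω * B k ω ^ n))
    ((hFi.const_mul _).sub (hFB.const_mul _)) (by
      filter_upwards [hL.pos k hk, hL.ineq k hk] with ω hω hi
      rw [pow_one] at hi
      exact mul_sub_le_of_le_mul n (hF0 ω) hω hlam hi)
  rw [integral_sub (hFi.const_mul _) (hFB.const_mul _), integral_const_mul,
    integral_const_mul] at h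
  refine h.trans (sub_le_sub_left (mul_le_mul_of_nonneg_left ?_ (h0 k)) _)
  have := mul_le_mul_of_nonneg_left hFBle (pow_pos hlam (n + 1)).le
  linarith

lemma recursion_of_lojasiewicz_two {k : ℕ} (hk : 1 ≤ k)
    (hL : LojasiewiczAlong ℙ μ (fun k ω => iterate μ σ₀ γ (fun j => P j ω) k) 2 B c)
    (lam : ℝ) :
    ∫ ω, loss μ (iterate μ σ₀ γ (fun j => P j ω) (k + 1)) ∂ℙ ≤
      (1 + γ k ^ 2) * ∫ ω, loss μ (iterate μ σ₀ γ (fun j => P j ω) k) ∂ℙ -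
        γ k * (lam * ∫ ω, loss μ (iterate μ σ₀ γ (fun j => P j ω) k) ∂ℙ -
          c 1 / 4 * lam ^ (1 + 1)) := by
  set F : Ω → ℝ := fun ω => loss μ (iterate μ σ₀ γ (fun j => P j ω) k) with hFdef
  have hFi : Integrable F ℙ := integrable_loss_iterate hd hμ hσ₀ h0 h1 hP k
  obtain ⟨hBi, hBc⟩ := hL.moment k hk 1 le_rfl
  simp only [pow_one] at hBi hBc
  have h := integral_loss_iterate_succ_le hd hμ hσ₀ h0 h1 hP k
    (R := fun ω => lam * F ω - lam ^ 2 / 4 * B k ω)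
    ((hFi.const_mul _).sub (hBi.const_mul _)) (by
      filter_upwards [hL.pos k hk, hL.ineq k hk] with ω hω hi
      exact mul_sub_le_of_sq_le_mul hω hi)
  rw [integral_sub (hFi.const_mul _) (hBi.const_mul _), integral_const_mul,
    integral_const_mul] at h
  refine h.trans (sub_le_sub_left (mul_le_mul_of_nonneg_left ?_ (h0 k)) _)
  have := mul_le_mul_of_nonneg_left hBc (by positivity : 0 ≤ lam ^ 2 / 4)
  linarith

end

lemma M2_nonneg {d : ℕ} (ν : Measure (E d)) : 0 ≤ M2 ν := by
  unfold M2
  positivity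

lemma stepSize_nonneg {s : ℝ} (hs : 1 ≤ s) (α : ℝ) (j : ℕ) : 0 ≤ 1 / ((j : ℝ) + s) ^ α := by
  positivity

lemma stepSize_le_one {s α : ℝ} (hs : 1 ≤ s) (hα : 0 ≤ α) (j : ℕ) :
    1 / ((j : ℝ) + s) ^ α ≤ 1 := by
  have h : 1 ≤ ((j : ℝ) + s) ^ α :=
    Real.one_le_rpow (by linarith [(j.cast_nonneg : (0 : ℝ) ≤ j)]) hα
  exact (div_le_one (by linarith)).2 h

end

end SliceMatching

theorem mainTheorem2 (c : ℕ → ℝ) (hc : ∀ p, 1 ≤ p → 0 < c p) (m : ℝ) :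
    (∀ α : ℝ, 1 / 2 < α → α < 1 → ∃ C : ℝ, 0 < C ∧
      ∀ (d : ℕ), 1 ≤ d → ∀ μ σ₀ : Measure (SliceMatching.E d),
      SliceMatching.IsP2ac μ → SliceMatching.IsP2ac σ₀ → SliceMatching.M2 μ = m →
      ∀ (Ω : Type*) [MeasurableSpace Ω] (ℙ : Measure Ω) [IsProbabilityMeasure ℙ]
        (P : ℕ → Ω → SliceMatching.Basis d) (B : ℕ → Ω → ℝ) (σ : ℕ → Ω → Measure (SliceMatching.E d)),
      SliceMatching.IsHaarSequence ℙ P →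
      (∀ k ω, σ k ω = SliceMatching.iterate μ σ₀ (fun j => 1 / ((j : ℝ) + 1) ^ α)
        (fun j => P j ω) k) →
      SliceMatching.LojasiewiczAlong ℙ μ σ 1 B c →
      ∀ k : ℕ, 1 ≤ k →
        Integrable (fun ω => SliceMatching.loss μ (σ k ω)) ℙ ∧
        ∫ ω, SliceMatching.loss μ (σ k ω) ∂ℙ ≤ C / (k : ℝ) ^ (2 * α - 1)) ∧
    (∀ (α : ℝ) (p : ℕ) (γ s : ℝ), 1 / 2 < α → α < 2 / 3 → 2 * α / (2 - 3 * α) ≤ (p : ℝ) →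
      γ = (2 * m * Real.sqrt (c p)) ^ ((3 : ℝ) / 2) → 1 ≤ γ → ∃ C : ℝ, 0 < C ∧
      ∀ (d : ℕ), 1 ≤ d → ∀ μ σ₀ : Measure (SliceMatching.E d),
      SliceMatching.IsP2ac μ → SliceMatching.IsP2ac σ₀ →
      SliceMatching.M2 μ = m → SliceMatching.M2 σ₀ = s →
      ∀ (Ω : Type*) [MeasurableSpace Ω] (ℙ : Measure Ω) [IsProbabilityMeasure ℙ]
        (P : ℕ → Ω → SliceMatching.Basis d) (B : ℕ → Ω → ℝ) (σ : ℕ → Ω → Measure (SliceMatching.E d)),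
      SliceMatching.IsHaarSequence ℙ P →
      (∀ k ω, σ k ω = SliceMatching.iterate μ σ₀ (fun j => 1 / ((j : ℝ) + γ) ^ α)
        (fun j => P j ω) k) →
      SliceMatching.LojasiewiczAlong ℙ μ σ 2 B c →
      ∀ k : ℕ, 1 ≤ k →
        Integrable (fun ω => SliceMatching.loss μ (σ k ω)) ℙ ∧
        ∫ ω, SliceMatching.loss μ (σ k ω) ∂ℙ ≤ C / ((k : ℝ) + γ) ^ (2 * α - 1)) := by
  refine ⟨fun α hα hα1 => ?_, fun α p γ s hα hα2 _ _ hγ => ?_⟩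
  · obtain ⟨n, hn⟩ := exists_nat_ge ((2 * α - 1) / (1 - α))
    have hn' : 2 * α - 1 ≤ n * (1 - α) := (div_le_iff₀ (by linarith)).1 hn
    have hn1 : 1 ≤ n := by
      by_contra! h0
      obtain rfl : n = 0 := by lia
      simp only [Nat.cast_zero, zero_mul] at hn'
      linarith
    refine ⟨max 1 (max ((m + m) * (1 + 1) ^ (2 * α - 1))
      (2 * ((m + m) * c n * (2 * α + 1) ^ (n + 1)))), by positivity, ?_⟩
    intro d hd μ σ₀ hμ hσ₀ hm Ω _ ℙ _ P B σ hP hσ hL k hk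
    obtain rfl : σ = fun k ω => SliceMatching.iterate μ σ₀ (fun j => 1 / ((j : ℝ) + 1) ^ α)
        (fun j => P j ω) k := by
      ext1 k; ext1 ω; exact hσ k ω
    have h0 := SliceMatching.stepSize_nonneg le_rfl α
    have h1 := SliceMatching.stepSize_le_one le_rfl (by linarith : 0 ≤ α)
    have hm0 : 0 ≤ m := hm ▸ SliceMatching.M2_nonneg μ
    refine ⟨SliceMatching.integrable_loss_iterate hd hμ hσ₀ h0 h1 hP k, ?_⟩
    -- the first step size is `1`, so that the second moment of the initial measure is forgotten
    have hM1 : ∀ Q, SliceMatching.M2 (SliceMatching.iterate μ σ₀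
        (fun j => 1 / ((j : ℝ) + 1) ^ α) Q 1) ≤ m := by
      intro Q
      refine (SliceMatching.M2_map_step_le hμ.toIsP2 hσ₀ (h0 0) (h1 0) (Q 0)).trans ?_
      simp [hm]
    have hK : ∀ j, 1 ≤ j → ∀ ω, SliceMatching.loss μ (SliceMatching.iterate μ σ₀
        (fun j => 1 / ((j : ℝ) + 1) ^ α) (fun i => P i ω) j) ≤ m + m := by
      intro j hj ω
      have h := SliceMatching.loss_iterate_le hd hμ hσ₀ h0 h1 hP
        (SliceMatching.M2_iterate_le hμ hσ₀ h0 h1 (fun i => P i ω) hm.le (hM1 _) hj)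
      rwa [hm] at h
    have hrate := SliceMatching.rate_of_recursion (s := 1) (K := m + m) (M := (m + m) * c n)
      hα hα1 le_rfl hn' (mul_nonneg (add_nonneg hm0 hm0) (hc n hn1).le)
      (a := fun k => ∫ ω, SliceMatching.loss μ (SliceMatching.iterate μ σ₀
        (fun j => 1 / ((j : ℝ) + 1) ^ α) (fun i => P i ω) k) ∂ℙ)
      (fun k => integral_nonneg fun ω => SliceMatching.loss_nonneg _ _)
      (by
        have h := integral_mono (SliceMatching.integrable_loss_iterate hd hμ hσ₀ h0 h1 hP 1)
          (integrable_const (m + m)) (hK 1 le_rfl)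
        simpa using h)
      (fun k hk lam hlam => SliceMatching.recursion_of_lojasiewicz_one hd hμ hσ₀ h0 h1 hP hn1 hk
        (add_nonneg hm0 hm0) (hK k hk) hL hlam)
      ((le_max_left _ _).trans (le_max_right 1 _)) ((le_max_right _ _).trans (le_max_right 1 _))
      k hk
    have hkpos : (0 : ℝ) < k := by exact_mod_cast hk
    refine hrate.trans (div_le_div_of_nonneg_left (by positivity) (by positivity) ?_)
    exact Real.rpow_le_rpow hkpos.le (by linarith) (by linarith)
  · refine ⟨max 1 (max ((max s m + m) * (1 + γ) ^ (2 * α - 1))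
      (2 * (c 1 / 4 * (2 * α + 1) ^ (1 + 1)))), by positivity, ?_⟩
    intro d hd μ σ₀ hμ hσ₀ hm hs Ω _ ℙ _ P B σ hP hσ hL k hk
    obtain rfl : σ = fun k ω => SliceMatching.iterate μ σ₀ (fun j => 1 / ((j : ℝ) + γ) ^ α)
        (fun j => P j ω) k := by
      ext1 k; ext1 ω; exact hσ k ω
    have h0 := SliceMatching.stepSize_nonneg hγ α
    have h1 := SliceMatching.stepSize_le_one hγ (by linarith : 0 ≤ α)
    refine ⟨SliceMatching.integrable_loss_iterate hd hμ hσ₀ h0 h1 hP k, ?_⟩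
    have hK : ∀ ω, SliceMatching.loss μ (SliceMatching.iterate μ σ₀
        (fun j => 1 / ((j : ℝ) + γ) ^ α) (fun i => P i ω) 1) ≤ max s m + m := by
      intro ω
      have h := SliceMatching.loss_iterate_le hd hμ hσ₀ h0 h1 hP
        (SliceMatching.M2_iterate_le hμ hσ₀ h0 h1 (fun i => P i ω) (R := max s m) (j := 0)
          (hm.le.trans (le_max_right _ _)) (hs.le.trans (le_max_left _ _)) zero_le_one)
      rwa [hm] at h
    exact SliceMatching.rate_of_recursion (n := 1) (K := max s m + m) (M := c 1 / 4)
      hα (by linarith) hγ (by push_cast; linarith) (by linarith [hc 1 le_rfl])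
      (a := fun k => ∫ ω, SliceMatching.loss μ (SliceMatching.iterate μ σ₀
        (fun j => 1 / ((j : ℝ) + γ) ^ α) (fun i => P i ω) k) ∂ℙ)
      (fun k => integral_nonneg fun ω => SliceMatching.loss_nonneg _ _)
      (by
        have h := integral_mono (SliceMatching.integrable_loss_iterate hd hμ hσ₀ h0 h1 hP 1)
          (integrable_const (max s m + m)) hK
        simpa using h)
      (fun k hk lam _ => SliceMatching.recursion_of_lojasiewicz_two hd hμ hσ₀ h0 h1 hP hk hL lam)
      ((le_max_left _ _).trans (le_max_right 1 _)) ((le_max_right _ _).trans (le_max_right 1 _))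
      k hk
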